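/- Lattice points of $\mathbb{R}^d$ are the points of $\mathbb{Z}^d$. Call a set $K\subset\mathbb{R}^d$ hollow if its interior contains no point of $\mathbb{Z}^d$. The lattice width of $K$ is the infimum, over all nonzero linear functionals $f$ on $\mathbb{R}^d$ with $f(\mathbb{Z}^d)\subseteq\mathbb{Z}$, of the length of the segment $f(K)$. Let $w_c(d)$, $w_p(d)$ and $w_s(d)$ be the suprema of the lattice widths of, respectively, all hollow $d$-dimensional convex bodies in $\mathbb{R}^d$, all hollow $d$-dimensional lattice polytopes in $\mathbb{R}^d$ (convex hulls of finitely many points of $\mathbb{Z}^d$, with nonempty interior), and all hollow $d$-dimensional lattice simplices in $\mathbb{R}^d$ (convex hulls of $d+1$ affinely independent points of $\mathbb{Z}^d$). **Theorem.** The limits below exist in $[0,\infty]$, and $$\lim_{d\to\infty}\frac{w_p(d)}{d}=\lim_{d\to\infty}\frac{w_c(d)}{d}\ \ge\ \frac{2+\sqrt2}{3}=1.138\dots,\qquad \lim_{d\to\infty}\frac{w_s(d)}{d}\ \ge\ \frac{102}{101}=1.0099\dots.$$ -/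

import Mathlib

open Filter Topology
open scoped ENNReal

namespace HollowWidth

/-- The lattice `ℤ^d` inside `ℝ^d`. -/
def intLattice (d : ℕ) : Set (Fin d → ℝ) :=
  {x | ∀ i, ∃ n : ℤ, x i = n}

/-- `f` belongs to the dual lattice: it takes integer values on `ℤ^d`. -/
def IsLatticeFunctional {d : ℕ} (f : Module.Dual ℝ (Fin d → ℝ)) : Prop :=
  ∀ x ∈ intLattice d, ∃ n : ℤ, f x = n

/-- `K` is hollow (lattice-free): no lattice point lies in its interior. -/
def IsHollow {d : ℕ} (K : Set (Fin d → ℝ)) : Prop :=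
  interior K ∩ intLattice d = ∅

/-- The width of `K` with respect to `f`: the length (diameter) of the segment `f(K)`. -/
noncomputable def widthAlong {d : ℕ} (K : Set (Fin d → ℝ)) (f : Module.Dual ℝ (Fin d → ℝ)) :
    ℝ≥0∞ :=
  Metric.ediam (f '' K)

/-- The lattice width of `K`: the infimum of the widths of `K` with respect to the nonzero
functionals of the dual lattice. -/
noncomputable def latticeWidth {d : ℕ} (K : Set (Fin d → ℝ)) : ℝ≥0∞ :=
  ⨅ (f : Module.Dual ℝ (Fin d → ℝ)) (_ : IsLatticeFunctional f) (_ : f ≠ 0), widthAlong K f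

/-- `K` is a `d`-dimensional convex body in `ℝ^d`. -/
def IsConvexBody {d : ℕ} (K : Set (Fin d → ℝ)) : Prop :=
  Convex ℝ K ∧ IsCompact K ∧ (interior K).Nonempty

/-- `K` is a lattice `d`-polytope in `ℝ^d`: it is the convex hull of finitely many lattice
points, and it is `d`-dimensional, that is, it has nonempty interior. -/
def IsLatticePolytope {d : ℕ} (K : Set (Fin d → ℝ)) : Prop :=
  (∃ V : Finset (Fin d → ℝ), (V : Set (Fin d → ℝ)) ⊆ intLattice d ∧
    K = convexHull ℝ (V : Set (Fin d → ℝ))) ∧ (interior K).Nonempty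

/-- `K` is a lattice `d`-simplex in `ℝ^d`: the convex hull of `d + 1` affinely independent
lattice points. -/
def IsLatticeSimplex {d : ℕ} (K : Set (Fin d → ℝ)) : Prop :=
  ∃ v : Fin (d + 1) → (Fin d → ℝ), AffineIndependent ℝ v ∧ (∀ i, v i ∈ intLattice d) ∧
    K = convexHull ℝ (Set.range v)

/-- `w_c(d)`: the supremum of the lattice widths of the hollow convex bodies in `ℝ^d`. -/
noncomputable def wc (d : ℕ) : ℝ≥0∞ :=
  ⨆ (K : Set (Fin d → ℝ)) (_ : IsConvexBody K) (_ : IsHollow K), latticeWidth K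

/-- `w_p(d)`: the supremum of the lattice widths of the hollow lattice `d`-polytopes. -/
noncomputable def wp (d : ℕ) : ℝ≥0∞ :=
  ⨆ (K : Set (Fin d → ℝ)) (_ : IsLatticePolytope K) (_ : IsHollow K), latticeWidth K

/-- `w_s(d)`: the supremum of the lattice widths of the hollow lattice `d`-simplices. -/
noncomputable def ws (d : ℕ) : ℝ≥0∞ :=
  ⨆ (K : Set (Fin d → ℝ)) (_ : IsLatticeSimplex K) (_ : IsHollow K), latticeWidth K

end HollowWidth

namespace HollowWidth
open scoped Pointwise NNReal

/-! Two constructions control the growth. A high pyramid over a polytope with vertex 0 shows that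
`wp` and `ws` are monotone. The direct sum of `k` copies of `D • C`, where `0 ∈ C`, has width at
least `D` times that of `C`, and it is hollow as soon as `(D / k) • C` is, because each of its
points has some block in `(D / k) • C` (`isHollow_directSum`, `mul_latticeWidth_le_directSum`).

With `D = k` this gives `w(kd) ≥ k * w(d)`, which with monotonicity bounds the lower limit of `w(n)
/ n` below by every `w(d) / d` (`div_le_liminf`), so the limit exists. The vertices of `C` need only
be integral after multiplication by `k`, so rational polytopes suffice to bound `wp`. As these
approximate convex bodies, `wc` and `wp` have the same limit (`exists_mul_latticeWidth_le_wp`).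

The constants come from two examples: a hollow tetrahedron of width at least `2 + √2` in dimension
3, and an empty lattice 4-simplex of width at least 4 that stays hollow after dilation by 102/101.
The latter allows `D / k = 102 / 101`, hence width `408 q` in dimension `404 q`. -/

/-! ### Comparison and translation of lattice widths. -/

theorem mul_widthAlong_le {d n : ℕ} {K : Set (Fin d → ℝ)} {S : Set (Fin n → ℝ)}
    (φ : (Fin d → ℝ) →ₗ[ℝ] (Fin n → ℝ)) (D : ℝ≥0) (b : Fin n → ℝ)
    (h : ∀ y ∈ K, b + D • φ y ∈ S) (f : Module.Dual ℝ (Fin n → ℝ)) :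
    (D : ℝ≥0∞) * widthAlong K (f ∘ₗ φ) ≤ widthAlong S f := by
  unfold widthAlong
  conv_lhs => rw [Metric.ediam]
  simp only [ENNReal.mul_iSup, iSup_le_iff]
  rintro _ ⟨x, hx, rfl⟩ _ ⟨y, hy, rfl⟩
  refine le_trans (le_of_eq ?_) (Metric.edist_le_ediam_of_mem (Set.mem_image_of_mem f (h x hx))
    (Set.mem_image_of_mem f (h y hy)))
  simp only [map_add, edist_add_left, NNReal.smul_def, map_smul, LinearMap.comp_apply]
  rw [edist_smul₀, NNReal.nnnorm_eq D]
  rfl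

/-- The pullback of `f` competes in the infimum for `K` only when it is nonzero. Functionals that
vanish on the image of `φ` need a separate argument in each application. -/
theorem mul_latticeWidth_le_widthAlong {d n : ℕ} {K : Set (Fin d → ℝ)} {S : Set (Fin n → ℝ)}
    (φ : (Fin d → ℝ) →ₗ[ℝ] (Fin n → ℝ)) (hφ : ∀ x ∈ intLattice d, φ x ∈ intLattice n)
    (D : ℝ≥0) (b : Fin n → ℝ) (h : ∀ y ∈ K, b + D • φ y ∈ S)
    {f : Module.Dual ℝ (Fin n → ℝ)} (hf : IsLatticeFunctional f) (hfφ : f ∘ₗ φ ≠ 0) :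
    (D : ℝ≥0∞) * latticeWidth K ≤ widthAlong S f := by
  refine le_trans (mul_le_mul_right ?_ _) (mul_widthAlong_le φ D b h f)
  exact iInf₂_le_of_le (f ∘ₗ φ) (fun x hx => hf _ (hφ x hx)) (iInf_le_of_le hfφ le_rfl)

theorem mul_latticeWidth_le {d : ℕ} {K S : Set (Fin d → ℝ)} (D : ℝ≥0) (b : Fin d → ℝ)
    (h : ∀ y ∈ K, b + D • y ∈ S) : (D : ℝ≥0∞) * latticeWidth K ≤ latticeWidth S := by
  refine le_iInf₂ fun f hf => le_iInf fun hf0 => ?_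
  exact mul_latticeWidth_le_widthAlong LinearMap.id (fun _ => id) D b h hf
    (by simpa using hf0)

theorem ofReal_le_latticeWidth {d : ℕ} {K : Set (Fin d → ℝ)} {w : ℝ}
    (h : ∀ f : Module.Dual ℝ (Fin d → ℝ), IsLatticeFunctional f → f ≠ 0 →
      ∃ x ∈ K, ∃ y ∈ K, w ≤ f x - f y) : ENNReal.ofReal w ≤ latticeWidth K := by
  refine le_iInf₂ fun f hf => le_iInf fun hf0 => ?_
  obtain ⟨x, hx, y, hy, hw⟩ := h f hf hf0
  refine le_trans ?_ (Metric.edist_le_ediam_of_mem (Set.mem_image_of_mem f hx)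
    (Set.mem_image_of_mem f hy))
  rw [edist_dist, Real.dist_eq]
  exact ENNReal.ofReal_le_ofReal (hw.trans (le_abs_self _))

theorem intLattice_add {d : ℕ} {x y : Fin d → ℝ} (hx : x ∈ intLattice d) (hy : y ∈ intLattice d) :
    x + y ∈ intLattice d := fun i => by
  obtain ⟨a, ha⟩ := hx i
  obtain ⟨b, hb⟩ := hy i
  exact ⟨a + b, by simp [ha, hb]⟩

theorem intLattice_neg {d : ℕ} {x : Fin d → ℝ} (hx : x ∈ intLattice d) : -x ∈ intLattice d :=
  fun i => by
    obtain ⟨a, ha⟩ := hx i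
    exact ⟨-a, by simp [ha]⟩

theorem zero_mem_intLattice (d : ℕ) : (0 : Fin d → ℝ) ∈ intLattice d := fun _ => ⟨0, by simp⟩

theorem IsHollow.vadd {d : ℕ} {K : Set (Fin d → ℝ)} (hK : IsHollow K) {p : Fin d → ℝ}
    (hp : p ∈ intLattice d) : IsHollow (p +ᵥ K) := by
  rw [IsHollow, Set.eq_empty_iff_forall_notMem]
  rintro x ⟨hx, hxl⟩
  rw [interior_vadd, Set.mem_vadd_set_iff_neg_vadd_mem, vadd_eq_add] at hx
  exact Set.eq_empty_iff_forall_notMem.1 hK _ ⟨hx, intLattice_add (intLattice_neg hp) hxl⟩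

theorem latticeWidth_le_vadd {d : ℕ} (K : Set (Fin d → ℝ)) (p : Fin d → ℝ) :
    latticeWidth K ≤ latticeWidth (p +ᵥ K) := by
  simpa using mul_latticeWidth_le (S := p +ᵥ K) 1 p
    (fun y hy => by simpa using Set.vadd_mem_vadd_set (a := p) hy)

theorem IsHollow.mono {d : ℕ} {K S : Set (Fin d → ℝ)} (hS : IsHollow S) (h : K ⊆ S) :
    IsHollow K := by
  rw [IsHollow, Set.eq_empty_iff_forall_notMem] at *
  exact fun x hx => hS x ⟨interior_mono h hx.1, hx.2⟩

/-- Coordinate embedding along an injection of the index sets. -/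
noncomputable def coordEmb {d n : ℕ} (e : Fin d → Fin n) : (Fin d → ℝ) →ₗ[ℝ] (Fin n → ℝ) :=
  Function.ExtendByZero.linearMap ℝ e

theorem coordEmb_apply {d n : ℕ} {e : Fin d → Fin n} (he : Function.Injective e)
    (x : Fin d → ℝ) (i : Fin d) : coordEmb e x (e i) = x i :=
  he.extend_apply x (0 : Fin n → ℝ) i

theorem coordEmb_apply' {d n : ℕ} {e : Fin d → Fin n} (x : Fin d → ℝ) {i : Fin n}
    (hi : ∀ j, e j ≠ i) : coordEmb e x i = 0 :=
  Function.extend_apply' x (0 : Fin n → ℝ) i (by simpa using hi)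

theorem coordEmb_mem_intLattice {d n : ℕ} {e : Fin d → Fin n} (he : Function.Injective e)
    {x : Fin d → ℝ} (hx : x ∈ intLattice d) : coordEmb e x ∈ intLattice n := fun i => by
  by_cases h : ∃ j, e j = i
  · obtain ⟨j, rfl⟩ := h
    rw [coordEmb_apply he]
    exact hx j
  · push Not at h
    exact ⟨0, by simp [coordEmb_apply' x h]⟩

/-- For `d + 1` points of `ℝ^d`, affine independence and affine spanning coincide. Polytopes and
simplices can then share the proofs about interiors. -/
theorem isLatticeSimplex_iff {d : ℕ} {K : Set (Fin d → ℝ)} : IsLatticeSimplex K ↔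
    ∃ v : Fin (d + 1) → (Fin d → ℝ), (∀ i, v i ∈ intLattice d) ∧
      K = convexHull ℝ (Set.range v) ∧ (interior K).Nonempty := by
  have key (v : Fin (d + 1) → (Fin d → ℝ)) :
      AffineIndependent ℝ v ↔ (interior (convexHull ℝ (Set.range v))).Nonempty := by
    rw [interior_convexHull_nonempty_iff_affineSpan_eq_top]
    constructor
    · intro h
      rw [h.affineSpan_eq_top_iff_card_eq_finrank_add_one]
      rw [Fintype.card_fin, Module.finrank_fin_fun]
    · intro h
      rw [affineIndependent_iff_finrank_vectorSpan_eq ℝ v (n := d) (Fintype.card_fin _),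
        ← direction_affineSpan, h]
      rw [AffineSubspace.direction_top, finrank_top, Module.finrank_fin_fun]
  constructor
  · rintro ⟨v, h1, h2, rfl⟩
    exact ⟨v, h2, rfl, (key v).1 h1⟩
  · rintro ⟨v, h1, rfl, h2⟩
    exact ⟨v, (key v).2 h2, h1, rfl⟩

theorem IsLatticePolytope.isConvexBody {d : ℕ} {K : Set (Fin d → ℝ)}
    (h : IsLatticePolytope K) : IsConvexBody K := by
  obtain ⟨⟨V, -, rfl⟩, h⟩ := h
  exact ⟨convex_convexHull ℝ _, V.finite_toSet.isCompact_convexHull ℝ, h⟩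

theorem wp_le_wc (d : ℕ) : wp d ≤ wc d :=
  iSup_le fun K => iSup_le fun hK => iSup_le fun hh =>
    le_iSup_of_le K (le_iSup_of_le hK.isConvexBody (le_iSup_of_le hh le_rfl))

theorem latticeWidth_le_wp {d : ℕ} {K : Set (Fin d → ℝ)} (hK : IsLatticePolytope K)
    (hh : IsHollow K) : latticeWidth K ≤ wp d :=
  le_iSup_of_le K (le_iSup_of_le hK (le_iSup_of_le hh le_rfl))

theorem latticeWidth_le_wc {d : ℕ} {K : Set (Fin d → ℝ)} (hK : IsConvexBody K)
    (hh : IsHollow K) : latticeWidth K ≤ wc d :=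
  le_iSup_of_le K (le_iSup_of_le hK (le_iSup_of_le hh le_rfl))

theorem latticeWidth_le_ws {d : ℕ} {K : Set (Fin d → ℝ)} (hK : IsLatticeSimplex K)
    (hh : IsHollow K) : latticeWidth K ≤ ws d :=
  le_iSup_of_le K (le_iSup_of_le hK (le_iSup_of_le hh le_rfl))

/-- A monotone sequence with `q * x ≤ a (q * N)` for all `q` grows at least like `n * (x / N)`. -/
theorem div_le_liminf {a : ℕ → ℝ≥0∞} (ha : Monotone a) {N : ℕ} (hN : N ≠ 0) {x : ℝ≥0∞}
    (h : ∀ q : ℕ, q ≠ 0 → (q : ℝ≥0∞) * x ≤ a (q * N)) :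
    x / N ≤ liminf (fun n : ℕ => a n / (n : ℝ≥0∞)) atTop := by
  have h1 : Tendsto (fun n : ℕ => ((n / N : ℕ) : ℝ) / (n : ℝ)) atTop (𝓝 (1 / N)) := by
    have h2 := (tendsto_nat_floor_mul_div_atTop (R := ℝ) (a := 1 / N) (by positivity)).comp
      (tendsto_natCast_atTop_atTop (R := ℝ))
    refine h2.congr fun n => ?_
    simp only [Function.comp_apply]
    congr 2
    rw [← Nat.floor_div_eq_div (K := ℝ), one_div_mul_eq_div]
  have h3 : Tendsto (fun n : ℕ => ((n / N : ℕ) : ℝ≥0∞) / (n : ℝ≥0∞)) atTop (𝓝 (1 / N)) := by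
    have h4 := ENNReal.tendsto_ofReal h1
    rw [ENNReal.ofReal_div_of_pos (by positivity), ENNReal.ofReal_one, ENNReal.ofReal_natCast] at h4
    refine h4.congr' ?_
    filter_upwards [eventually_gt_atTop 0] with n hn
    rw [ENNReal.ofReal_div_of_pos (by positivity), ENNReal.ofReal_natCast, ENNReal.ofReal_natCast]
  have h5 := ENNReal.Tendsto.mul_const (b := x) h3 (Or.inl (by simp))
  have h6 : x / N = 1 / N * x := by rw [ENNReal.div_eq_inv_mul, one_div]
  rw [h6, ← h5.liminf_eq]
  refine liminf_le_liminf ?_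
  filter_upwards [eventually_ge_atTop N] with n hn
  -- Round `n` down to a multiple of `N`; monotonicity covers the indices in between.
  have h7 : ((n / N : ℕ) : ℝ≥0∞) * x ≤ a n :=
    (h _ (Nat.div_pos hn (Nat.pos_of_ne_zero hN)).ne').trans (ha (Nat.div_mul_le_self n N))
  calc ((n / N : ℕ) : ℝ≥0∞) / (n : ℝ≥0∞) * x = ((n / N : ℕ) : ℝ≥0∞) * x / n := by
        rw [ENNReal.div_eq_inv_mul, ENNReal.div_eq_inv_mul, mul_assoc]
    _ ≤ _ := by gcongr

theorem isLatticePolytope_convexHull {d : ℕ} {V : Set (Fin d → ℝ)} (hfin : V.Finite)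
    (hlat : V ⊆ intLattice d) (hint : (interior (convexHull ℝ V)).Nonempty) :
    IsLatticePolytope (convexHull ℝ V) :=
  ⟨⟨hfin.toFinset, by simpa using hlat, by simp⟩, hint⟩

/-- Pyramids and direct sums both need the origin among the vertices; a lattice translation puts it
there. -/
theorem IsLatticePolytope.exists_zero_mem {d : ℕ} {K : Set (Fin d → ℝ)}
    (hK : IsLatticePolytope K) (hh : IsHollow K) :
    ∃ V : Set (Fin d → ℝ), V.Finite ∧ V ⊆ intLattice d ∧ (0 : Fin d → ℝ) ∈ V ∧
      (interior (convexHull ℝ V)).Nonempty ∧ IsHollow (convexHull ℝ V) ∧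
      latticeWidth K ≤ latticeWidth (convexHull ℝ V) := by
  obtain ⟨⟨V, hV, rfl⟩, hint⟩ := hK
  obtain ⟨p, hp⟩ : (V : Set (Fin d → ℝ)).Nonempty := by
    rw [← convexHull_nonempty_iff (𝕜 := ℝ)]
    exact hint.mono interior_subset
  refine ⟨-p +ᵥ (V : Set (Fin d → ℝ)), V.finite_toSet.vadd_set, ?_,
    by simpa using Set.vadd_mem_vadd_set (a := -p) hp, ?_, ?_, ?_⟩
  · rintro _ ⟨x, hx, rfl⟩
    exact intLattice_add (intLattice_neg (hV hp)) (hV hx)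
  · rw [convexHull_vadd, interior_vadd]
    exact hint.vadd_set
  · rw [convexHull_vadd]
    exact hh.vadd (intLattice_neg (hV hp))
  · rw [convexHull_vadd]
    exact latticeWidth_le_vadd _ _

theorem IsLatticeSimplex.exists_zero_vertex {d : ℕ} {K : Set (Fin d → ℝ)}
    (hK : IsLatticeSimplex K) (hh : IsHollow K) :
    ∃ v : Fin (d + 1) → (Fin d → ℝ), v 0 = 0 ∧ (∀ i, v i ∈ intLattice d) ∧
      (interior (convexHull ℝ (Set.range v))).Nonempty ∧ IsHollow (convexHull ℝ (Set.range v)) ∧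
      latticeWidth K ≤ latticeWidth (convexHull ℝ (Set.range v)) := by
  obtain ⟨v, hv, rfl, hint⟩ := isLatticeSimplex_iff.1 hK
  have hr : Set.range (fun i => -v 0 + v i) = -v 0 +ᵥ Set.range v := by
    ext x
    simp [Set.mem_vadd_set]
  refine ⟨fun i => -v 0 + v i, by simp, fun i => intLattice_add (intLattice_neg (hv 0)) (hv i),
    ?_, ?_, ?_⟩
  · rw [hr, convexHull_vadd, interior_vadd]
    exact hint.vadd_set
  · rw [hr, convexHull_vadd]
    exact hh.vadd (intLattice_neg (hv 0))
  · rw [hr, convexHull_vadd]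
    exact latticeWidth_le_vadd _ _

/-! ### Pyramids and monotonicity in the dimension. -/

/-- Apex of the pyramid of height `M` over a set in the hyperplane `x₀ = 0`. -/
noncomputable def apex (d : ℕ) (M : ℝ) : Fin (d + 1) → ℝ := Pi.single 0 M

/-- Vertices of the pyramid of height `M` over `V`. -/
noncomputable def pyramid {d : ℕ} (V : Set (Fin d → ℝ)) (M : ℝ) : Set (Fin (d + 1) → ℝ) :=
  insert (apex d M) (coordEmb Fin.succ '' V)

theorem coordEmb_succ_add_apex {d : ℕ} (x : Fin (d + 1) → ℝ) :
    coordEmb Fin.succ (fun i => x i.succ) + x 0 • apex d 1 = x := by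
  ext i
  refine Fin.cases ?_ (fun i => ?_) i
  · rw [Pi.add_apply, coordEmb_apply' _ (fun j => Fin.succ_ne_zero j)]
    simp [apex]
  · rw [Pi.add_apply, coordEmb_apply (Fin.succ_injective d)]
    simp [apex]

theorem smul_apex {d : ℕ} (s M : ℝ) : s • apex d M = apex d (s * M) := by
  rw [apex, ← Pi.single_smul, smul_eq_mul, apex]

/-- The apex lies above `0 ∈ V`, so the pyramid sits in the cylinder over its base. The projection
is open and preserves lattice points, so an interior lattice point would project to one of the base.
-/
theorem isHollow_pyramid {d : ℕ} {V : Set (Fin d → ℝ)} {M : ℝ} (h0 : (0 : Fin d → ℝ) ∈ V)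
    (hV : IsHollow (convexHull ℝ V)) : IsHollow (convexHull ℝ (pyramid V M)) := by
  let pr : (Fin (d + 1) → ℝ) →ₗ[ℝ] (Fin d → ℝ) := LinearMap.funLeft ℝ ℝ Fin.succ
  have hsub : convexHull ℝ (pyramid V M) ⊆ pr ⁻¹' convexHull ℝ V := by
    refine convexHull_min ?_ ((convex_convexHull ℝ V).linear_preimage pr)
    rintro x (rfl | ⟨y, hy, rfl⟩)
    · have : pr (apex d M) = 0 := by
        ext i
        simp [pr, apex, LinearMap.funLeft_apply]
      rw [Set.mem_preimage, this]
      exact subset_convexHull ℝ V h0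
    · have : pr (coordEmb Fin.succ y) = y := by
        ext i
        simp [pr, LinearMap.funLeft_apply, coordEmb_apply (Fin.succ_injective d)]
      rw [Set.mem_preimage, this]
      exact subset_convexHull ℝ V hy
  have hopen : IsOpenMap pr := pr.isOpenMap_of_finiteDimensional
    (LinearMap.funLeft_surjective_of_injective ℝ ℝ _ (Fin.succ_injective d))
  rw [IsHollow, Set.eq_empty_iff_forall_notMem] at *
  rintro x ⟨hx, hxl⟩
  exact hV (pr x) ⟨hopen.interior_preimage_subset_preimage_interior (interior_mono hsub hx),
    fun i => hxl _⟩

/-- A functional that is nonzero on the base hyperplane already has the width of the base. Any other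
is a nonzero integer multiple of `x₀`, and the segment from 0 to the apex gives it width at least
`M`. -/
theorem min_le_latticeWidth_pyramid {d : ℕ} {V : Set (Fin d → ℝ)} {M : ℝ} (hM : 0 ≤ M)
    (h0 : (0 : Fin d → ℝ) ∈ V) :
    min (latticeWidth (convexHull ℝ V)) (ENNReal.ofReal M) ≤
      latticeWidth (convexHull ℝ (pyramid V M)) := by
  refine le_iInf₂ fun f hf => le_iInf fun hf0 => ?_
  by_cases hφ : f ∘ₗ coordEmb Fin.succ = 0
  · refine (min_le_right _ _).trans ?_
    have hfx (x : Fin (d + 1) → ℝ) : f x = x 0 * f (apex d 1) := by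
      conv_lhs => rw [← coordEmb_succ_add_apex x]
      rw [map_add, map_smul, ← LinearMap.comp_apply, hφ]
      simp
    obtain ⟨n, hn⟩ := hf (apex d 1) (fun i => by
      refine Fin.cases ⟨1, by simp [apex]⟩ (fun i => ⟨0, by simp [apex]⟩) i)
    have hn0 : n ≠ 0 := by
      rintro rfl
      refine hf0 (LinearMap.ext fun x => ?_)
      rw [hfx, hn]
      simp
    have h1 : apex d M ∈ convexHull ℝ (pyramid V M) :=
      subset_convexHull ℝ _ (Set.mem_insert _ _)
    have h2 : (0 : Fin (d + 1) → ℝ) ∈ convexHull ℝ (pyramid V M) :=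
      subset_convexHull ℝ _ (Set.mem_insert_of_mem _ ⟨0, h0, map_zero _⟩)
    refine le_trans ?_ (Metric.edist_le_ediam_of_mem (Set.mem_image_of_mem f h1)
      (Set.mem_image_of_mem f h2))
    rw [edist_dist, Real.dist_eq, map_zero, sub_zero, hfx, hn, apex, Pi.single_eq_same, abs_mul,
      abs_of_nonneg hM]
    refine ENNReal.ofReal_le_ofReal (le_mul_of_one_le_right hM ?_)
    exact_mod_cast Int.one_le_abs hn0
  · refine (min_le_left _ _).trans ?_
    have := mul_latticeWidth_le_widthAlong (K := convexHull ℝ V)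
      (S := convexHull ℝ (pyramid V M)) (coordEmb Fin.succ)
      (fun x hx => coordEmb_mem_intLattice (Fin.succ_injective d) hx) 1 0 (fun y hy => ?_) hf hφ
    · simpa using this
    · rw [zero_add, one_smul]
      have h3 := Set.mem_image_of_mem (coordEmb (Fin.succ (n := d))) hy
      rw [LinearMap.image_convexHull] at h3
      exact convexHull_mono (Set.subset_insert _ _) h3

theorem interior_pyramid_nonempty {d : ℕ} {V : Set (Fin d → ℝ)} {M : ℝ} (hM : 0 < M)
    (h0 : (0 : Fin d → ℝ) ∈ V) (hV : (interior (convexHull ℝ V)).Nonempty) :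
    (interior (convexHull ℝ (pyramid V M))).Nonempty := by
  set C := convexHull ℝ V
  set S := convexHull ℝ (pyramid V M)
  -- At height `s * M` with `s < 1/2` the slice contains `(1 - s) • C`, hence `(1/2) • C`, because
  -- `0 ∈ C`.
  let U : Set (Fin (d + 1) → ℝ) :=
    {x | (fun i : Fin d => 2 * x i.succ) ∈ interior C ∧ 0 < x 0 ∧ x 0 < M / 2}
  have hU : IsOpen U := by
    refine IsOpen.inter ?_ (IsOpen.inter ?_ ?_)
    · exact isOpen_interior.preimage (f := fun (x : Fin (d + 1) → ℝ) (i : Fin d) => 2 * x i.succ)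
        (by fun_prop)
    · exact isOpen_lt continuous_const (continuous_apply 0)
    · exact isOpen_lt (continuous_apply 0) continuous_const
  have hUS : U ⊆ S := by
    rintro x ⟨hx, hx0, hxM⟩
    have hs : x 0 / M < 1 / 2 := by rw [div_lt_iff₀ hM]; linarith
    have hs0 : 0 < x 0 / M := by positivity
    set s := x 0 / M with hsdef
    have hy := (convex_convexHull ℝ V).smul_mem_of_zero_mem (subset_convexHull ℝ V h0)
      (interior_subset hx) (t := 1 / 2 / (1 - s))
      ⟨by have : 0 < 1 - s := by linarith
          positivity, by rw [div_le_one (by linarith)]; linarith⟩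
    have h3 := Set.mem_image_of_mem (coordEmb (Fin.succ (n := d))) hy
    rw [LinearMap.image_convexHull] at h3
    have h4 : coordEmb Fin.succ _ ∈ S := convexHull_mono (Set.subset_insert _ _) h3
    have h5 : apex d M ∈ S := subset_convexHull ℝ _ (Set.mem_insert _ _)
    have h6 := (convex_convexHull ℝ (pyramid V M)) h4 h5 (a := 1 - s) (b := s) (by linarith)
      hs0.le (by ring)
    convert h6 using 1
    conv_lhs => rw [← coordEmb_succ_add_apex x]
    rw [← map_smul, smul_smul, smul_apex, smul_apex]
    congr 2
    · ext i
      have : (1 - s) ≠ 0 := by linarith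
      simp only [Pi.smul_apply, smul_eq_mul]
      field_simp
    · rw [hsdef]
      field_simp
  obtain ⟨y, hy⟩ := hV
  refine ⟨Fin.cons (M / 4) ((1 / 2 : ℝ) • y), interior_maximal hUS hU ⟨?_, ?_, ?_⟩⟩
  · convert hy using 1
    ext i
    simp
  · simpa using hM
  · simp only [Fin.cons_zero]
    linarith

theorem pyramid_subset_intLattice {d : ℕ} {V : Set (Fin d → ℝ)} (hV : V ⊆ intLattice d) (M : ℕ) :
    pyramid V M ⊆ intLattice (d + 1) := by
  rintro x (rfl | ⟨y, hy, rfl⟩)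
  · exact fun i => Fin.cases ⟨M, by simp [apex]⟩ (fun i => ⟨0, by simp [apex]⟩) i
  · exact coordEmb_mem_intLattice (Fin.succ_injective d) (hV hy)

/-- Lets the height of the pyramid tend to infinity without knowing that lattice widths are finite.
-/
theorem le_of_forall_min_natCast_le {a b : ℝ≥0∞}
    (h : ∀ M : ℕ, 0 < M → min a (ENNReal.ofReal M) ≤ b) : a ≤ b := by
  refine le_of_forall_lt fun c hc => ?_
  obtain ⟨c', hc', hc''⟩ := exists_between hc
  obtain ⟨M, hM⟩ := ENNReal.exists_nat_gt hc''.ne_top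
  have hM0 : 0 < M := by
    rcases Nat.eq_zero_or_pos M with rfl | h
    · simp at hM
    · exact h
  refine hc'.trans_le (le_trans (le_min hc''.le ?_) (h M hM0))
  rw [ENNReal.ofReal_natCast]
  exact hM.le

theorem wp_le_succ (d : ℕ) : wp d ≤ wp (d + 1) := by
  refine iSup_le fun K => iSup₂_le fun hK hh => ?_
  obtain ⟨V, hfin, hlat, h0, hint, hhol, hle⟩ := hK.exists_zero_mem hh
  refine hle.trans (le_of_forall_min_natCast_le fun M hM => ?_)
  have hM' : (0 : ℝ) < M := by exact_mod_cast hM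
  refine (min_le_latticeWidth_pyramid hM'.le h0).trans
    (latticeWidth_le_wp (isLatticePolytope_convexHull ((hfin.image _).insert _)
      (pyramid_subset_intLattice hlat M) (interior_pyramid_nonempty hM' h0 hint))
      (isHollow_pyramid h0 hhol))

theorem ws_le_succ (d : ℕ) : ws d ≤ ws (d + 1) := by
  refine iSup_le fun K => iSup₂_le fun hK hh => ?_
  obtain ⟨v, hv0, hlat, hint, hhol, hle⟩ := hK.exists_zero_vertex hh
  have h0 : (0 : Fin d → ℝ) ∈ Set.range v := ⟨0, hv0⟩
  refine hle.trans (le_of_forall_min_natCast_le fun M hM => ?_)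
  have hM' : (0 : ℝ) < M := by exact_mod_cast hM
  have hr : Set.range (Fin.cons (apex d M) (fun i => coordEmb Fin.succ (v i)) :
      Fin (d + 1 + 1) → (Fin (d + 1) → ℝ)) = pyramid (Set.range v) M := by
    rw [Fin.range_cons, pyramid, ← Set.range_comp]
    rfl
  refine (min_le_latticeWidth_pyramid hM'.le h0).trans
    (latticeWidth_le_ws (isLatticeSimplex_iff.2 ⟨_, fun i => ?_, by rw [hr],
      interior_pyramid_nonempty hM' h0 hint⟩) (isHollow_pyramid h0 hhol))
  refine pyramid_subset_intLattice (V := Set.range v) ?_ M (hr ▸ Set.mem_range_self i)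
  rintro _ ⟨j, rfl⟩
  exact hlat j

/-! ### Direct sums of dilated copies. -/

/-- The `j`-th block of `d` coordinates among `k * d`. -/
def block (k d : ℕ) (j : Fin k) (i : Fin d) : Fin (k * d) := finProdFinEquiv (j, i)

theorem block_injective (k d : ℕ) (j : Fin k) : Function.Injective (block k d j) :=
  fun a b h => by simpa [block] using h

theorem block_ne {k d : ℕ} {j j' : Fin k} (h : j ≠ j') (i i' : Fin d) :
    block k d j i ≠ block k d j' i' :=
  fun h' => h (Prod.ext_iff.1 (finProdFinEquiv.injective h')).1

theorem exists_block {k d : ℕ} (i : Fin (k * d)) : ∃ j l, block k d j l = i :=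
  ⟨_, _, finProdFinEquiv.apply_symm_apply i⟩

/-- The projection of `ℝ^{kd}` onto its `j`-th block. -/
def blockProj (k d : ℕ) (j : Fin k) : (Fin (k * d) → ℝ) →ₗ[ℝ] (Fin d → ℝ) :=
  LinearMap.funLeft ℝ ℝ (block k d j)

theorem blockProj_apply {k d : ℕ} (j : Fin k) (x : Fin (k * d) → ℝ) (i : Fin d) :
    blockProj k d j x i = x (block k d j i) := rfl

theorem blockProj_coordEmb_self {k d : ℕ} (j : Fin k) (y : Fin d → ℝ) :
    blockProj k d j (coordEmb (block k d j) y) = y := by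
  ext i
  rw [blockProj_apply, coordEmb_apply (block_injective k d j)]

theorem blockProj_coordEmb_of_ne {k d : ℕ} {j j' : Fin k} (h : j ≠ j') (y : Fin d → ℝ) :
    blockProj k d j (coordEmb (block k d j') y) = 0 := by
  ext i
  rw [blockProj_apply, coordEmb_apply' _ (fun l => block_ne h.symm l i)]
  rfl

theorem ext_blockProj {k d : ℕ} {x y : Fin (k * d) → ℝ}
    (h : ∀ j, blockProj k d j x = blockProj k d j y) : x = y := by
  ext i
  obtain ⟨j, l, rfl⟩ := exists_block i
  exact congrFun (h j) l

theorem blockProj_sum_coordEmb {k d : ℕ} (y : Fin k → Fin d → ℝ) (j : Fin k) :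
    blockProj k d j (∑ i, coordEmb (block k d i) (y i)) = y j := by
  rw [map_sum, Finset.sum_eq_single j]
  · exact blockProj_coordEmb_self j _
  · exact fun i _ hi => blockProj_coordEmb_of_ne hi.symm _
  · simp

theorem sum_coordEmb_blockProj {k d : ℕ} (x : Fin (k * d) → ℝ) :
    ∑ j, coordEmb (block k d j) (blockProj k d j x) = x :=
  ext_blockProj fun j => by rw [blockProj_sum_coordEmb]

/-- Vertices of the direct sum of `k` copies of `D • conv V`. -/
noncomputable def directSum {d : ℕ} (k : ℕ) (V : Set (Fin d → ℝ)) (D : ℕ) :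
    Set (Fin (k * d) → ℝ) :=
  ⋃ j : Fin k, (fun y => (D : ℝ) • coordEmb (block k d j) y) '' V

theorem smul_coordEmb_mem_directSum {d k D : ℕ} {V : Set (Fin d → ℝ)} (j : Fin k)
    {y : Fin d → ℝ} (hy : y ∈ convexHull ℝ V) :
    (D : ℝ) • coordEmb (block k d j) y ∈ convexHull ℝ (directSum k V D) := by
  have h3 := Set.mem_image_of_mem ((D : ℝ) • coordEmb (block k d j)) hy
  rw [LinearMap.image_convexHull] at h3
  exact convexHull_mono
    (Set.subset_iUnion (fun j : Fin k => (fun y => (D : ℝ) • coordEmb (block k d j) y) '' V) j) h3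

theorem smul_subset_smul_of_le {d : ℕ} {C : Set (Fin d → ℝ)} (hC : Convex ℝ C)
    (h0 : (0 : Fin d → ℝ) ∈ C) {a b : ℝ} (ha : 0 ≤ a) (hb : 0 < b) (hab : a ≤ b) :
    a • C ⊆ b • C := by
  rintro _ ⟨y, hy, rfl⟩
  refine ⟨(a / b) • y, hC.smul_mem_of_zero_mem h0 hy ⟨by positivity, (div_le_one hb).2 hab⟩, ?_⟩
  simp only [smul_smul]
  congr 1
  field_simp

/-- The blocks of a point of the direct sum lie in `(l j * D) • C` with nonnegative weights of sum
at most 1. Some weight is at most `1 / k`, and dilates of `C` grow with the factor since `0 ∈ C`. -/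
theorem exists_blockProj_mem {d k D : ℕ} (hk : 0 < k) (hD : 0 < D) {V : Set (Fin d → ℝ)}
    (h0 : (0 : Fin d → ℝ) ∈ V) {x : Fin (k * d) → ℝ} (hx : x ∈ convexHull ℝ (directSum k V D)) :
    ∃ j, blockProj k d j x ∈ ((D : ℝ) / k) • convexHull ℝ V := by
  set C := convexHull ℝ V with hCdef
  have hC : Convex ℝ C := convex_convexHull ℝ V
  have hC0 : (0 : Fin d → ℝ) ∈ C := subset_convexHull ℝ V h0
  let H : Set (Fin (k * d) → ℝ) := {x | ∃ l : Fin k → ℝ, (∀ j, 0 ≤ l j) ∧ ∑ j, l j ≤ 1 ∧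
    ∀ j, blockProj k d j x ∈ (l j * D) • C}
  have hH : Convex ℝ H := by
    rintro x ⟨l, hl0, hl1, hl⟩ y ⟨m, hm0, hm1, hm⟩ a b ha hb hab
    refine ⟨fun j => a * l j + b * m j, fun j => add_nonneg (mul_nonneg ha (hl0 j))
      (mul_nonneg hb (hm0 j)), ?_, fun j => ?_⟩
    · rw [Finset.sum_add_distrib, ← Finset.mul_sum, ← Finset.mul_sum]
      nlinarith
    · rw [add_mul, hC.add_smul (mul_nonneg (mul_nonneg ha (hl0 j)) D.cast_nonneg)
        (mul_nonneg (mul_nonneg hb (hm0 j)) D.cast_nonneg), map_add, map_smul, map_smul,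
        mul_assoc a, mul_assoc b, mul_smul a, mul_smul b]
      exact Set.add_mem_add (Set.smul_mem_smul_set (hl j)) (Set.smul_mem_smul_set (hm j))
  have hVH : directSum k V D ⊆ H := by
    refine Set.iUnion_subset fun i => ?_
    rintro _ ⟨y, hy, rfl⟩
    refine ⟨Pi.single i 1, fun j => ?_, by simp, fun j => ?_⟩
    · by_cases h : j = i
      · subst h; simp
      · simp [h]
    · simp only [map_smul]
      by_cases h : j = i
      · subst h
        rw [blockProj_coordEmb_self, Pi.single_eq_same, one_mul]
        exact Set.smul_mem_smul_set (subset_convexHull ℝ V hy)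
      · rw [blockProj_coordEmb_of_ne h, smul_zero]
        exact ⟨0, hC0, smul_zero _⟩
  obtain ⟨l, hl0, hl1, hl⟩ := convexHull_min hVH hH hx
  have hk' : (0 : ℝ) < k := by exact_mod_cast hk
  have hD' : (0 : ℝ) < D := by exact_mod_cast hD
  have : Nonempty (Fin k) := ⟨⟨0, hk⟩⟩
  obtain ⟨j, -, hj⟩ := Finset.exists_le_of_sum_le (s := Finset.univ) (f := l)
    (g := fun _ => 1 / (k : ℝ)) Finset.univ_nonempty (by
      rw [Finset.sum_const, Finset.card_univ, Fintype.card_fin, nsmul_eq_mul,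
        mul_one_div_cancel hk'.ne']
      exact hl1)
  refine ⟨j, smul_subset_smul_of_le hC hC0 (mul_nonneg (hl0 j) hD'.le) (by positivity) ?_ (hl j)⟩
  calc l j * D ≤ 1 / (k : ℝ) * D := by gcongr
    _ = D / k := by ring

theorem mem_directSum_of_blockProj {d k D : ℕ} (hk : 0 < k) {V : Set (Fin d → ℝ)}
    {x : Fin (k * d) → ℝ} (hx : ∀ j, blockProj k d j x ∈ ((D : ℝ) / k) • convexHull ℝ V) :
    x ∈ convexHull ℝ (directSum k V D) := by
  have hk' : (0 : ℝ) < k := by exact_mod_cast hk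
  choose y hy hyx using hx
  have hxs : x = ∑ j, (1 / (k : ℝ)) • ((D : ℝ) • coordEmb (block k d j) (y j)) := by
    conv_lhs => rw [← sum_coordEmb_blockProj x]
    refine Finset.sum_congr rfl fun j _ => ?_
    rw [← hyx, map_smul, smul_smul]
    congr 1
    ring
  rw [hxs]
  refine (convex_convexHull ℝ _).sum_mem (fun _ _ => by positivity) ?_
    (fun j _ => smul_coordEmb_mem_directSum j (hy j))
  rw [Finset.sum_const, Finset.card_univ, Fintype.card_fin, nsmul_eq_mul,
    mul_one_div_cancel hk'.ne']

theorem exists_interior_directSum {d k D : ℕ} (hk : 0 < k) (hD : 0 < D) {V : Set (Fin d → ℝ)}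
    (hint : (interior (convexHull ℝ V)).Nonempty) :
    ∃ c ∈ interior (convexHull ℝ (directSum k V D)),
      ∀ j, blockProj k d j c ∈ interior (((D : ℝ) / k) • convexHull ℝ V) := by
  have hk' : (0 : ℝ) < k := by exact_mod_cast hk
  have hD' : (0 : ℝ) < D := by exact_mod_cast hD
  obtain ⟨y, hy⟩ := hint
  let U : Set (Fin (k * d) → ℝ) :=
    ⋂ j, blockProj k d j ⁻¹' interior (((D : ℝ) / k) • convexHull ℝ V)
  have hU : IsOpen U := isOpen_iInter_of_finite fun j =>
    isOpen_interior.preimage (blockProj k d j).continuous_of_finiteDimensional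
  have hUS : U ⊆ convexHull ℝ (directSum k V D) := fun x hx =>
    mem_directSum_of_blockProj hk fun j => interior_subset (Set.mem_iInter.1 hx j)
  have hc (j : Fin k) : blockProj k d j (∑ i, coordEmb (block k d i) (((D : ℝ) / k) • y)) ∈
      interior (((D : ℝ) / k) • convexHull ℝ V) := by
    rw [blockProj_sum_coordEmb, interior_smul₀ (by positivity)]
    exact Set.smul_mem_smul_set hy
  exact ⟨_, interior_maximal hUS hU (Set.mem_iInter.2 hc), hc⟩

theorem interior_directSum_nonempty {d k D : ℕ} (hk : 0 < k) (hD : 0 < D) {V : Set (Fin d → ℝ)}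
    (hint : (interior (convexHull ℝ V)).Nonempty) :
    (interior (convexHull ℝ (directSum k V D))).Nonempty :=
  let ⟨c, hc, _⟩ := exists_interior_directSum hk hD hint
  ⟨c, hc⟩

/-- An interior lattice point `x` can be pushed slightly away from `c` within the sum. Some block of
the pushed point lies in `(D / k) • C`. The same block of `x` lies strictly between it and an
interior point, so it is an interior lattice point of `(D / k) • C`. -/
theorem isHollow_directSum {d k D : ℕ} (hk : 0 < k) (hD : 0 < D) {V : Set (Fin d → ℝ)}
    (h0 : (0 : Fin d → ℝ) ∈ V) (hint : (interior (convexHull ℝ V)).Nonempty)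
    (hhol : IsHollow (((D : ℝ) / k) • convexHull ℝ V)) :
    IsHollow (convexHull ℝ (directSum k V D)) := by
  obtain ⟨c, -, hc⟩ := exists_interior_directSum hk hD hint
  rw [IsHollow, Set.eq_empty_iff_forall_notMem] at *
  rintro x ⟨hx, hxl⟩
  have hcont : Tendsto (fun t : ℝ => x + t • (x - c)) (𝓝[>] 0) (𝓝 x) := by
    have : Continuous (fun t : ℝ => x + t • (x - c)) := by fun_prop
    have h := this.tendsto 0
    rw [zero_smul, add_zero] at h
    exact h.mono_left nhdsWithin_le_nhds
  obtain ⟨t, htS, ht⟩ := ((hcont.eventually (isOpen_interior.mem_nhds hx)).and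
    self_mem_nhdsWithin).exists
  have ht : 0 < t := ht
  obtain ⟨j, hj⟩ := exists_blockProj_mem hk hD h0 (interior_subset htS)
  refine hhol (blockProj k d j x) ⟨?_, fun i => hxl _⟩
  have hconv : Convex ℝ (((D : ℝ) / k) • convexHull ℝ V) := (convex_convexHull ℝ V).smul _
  have h := hconv.combo_interior_self_mem_interior (hc j) hj (a := t / (1 + t))
    (b := 1 / (1 + t)) (by positivity) (by positivity) (by field_simp; ring)
  convert h using 1
  rw [← map_smul, ← map_smul, ← map_add]
  congr 1
  ext i
  simp only [Pi.add_apply, Pi.smul_apply, Pi.sub_apply, smul_eq_mul]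
  field_simp
  ring

/-- A nonzero functional is nonzero on some block, and the sum contains a full copy of `D • conv V`
there. -/
theorem mul_latticeWidth_le_directSum {d k D : ℕ} (V : Set (Fin d → ℝ)) :
    (D : ℝ≥0∞) * latticeWidth (convexHull ℝ V) ≤
      latticeWidth (convexHull ℝ (directSum k V D)) := by
  refine le_iInf₂ fun f hf => le_iInf fun hf0 => ?_
  obtain ⟨j, hj⟩ : ∃ j : Fin k, f ∘ₗ coordEmb (block k d j) ≠ 0 := by
    by_contra! h
    refine hf0 (LinearMap.ext fun x => ?_)
    rw [← sum_coordEmb_blockProj x, map_sum]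
    exact Finset.sum_eq_zero fun j _ => LinearMap.congr_fun (h j) _
  have := mul_latticeWidth_le_widthAlong (K := convexHull ℝ V)
    (S := convexHull ℝ (directSum k V D)) (coordEmb (block k d j))
    (fun x hx => coordEmb_mem_intLattice (block_injective k d j) hx) D 0 (fun y hy => ?_) hf hj
  · simpa using this
  · rw [zero_add, NNReal.smul_def]
    exact smul_coordEmb_mem_directSum j hy

theorem directSum_subset_intLattice {d k D : ℕ} {V : Set (Fin d → ℝ)}
    (hV : ∀ y ∈ V, (D : ℝ) • y ∈ intLattice d) : directSum k V D ⊆ intLattice (k * d) := by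
  refine Set.iUnion_subset fun j => ?_
  rintro _ ⟨y, hy, rfl⟩
  simp only [← map_smul]
  exact coordEmb_mem_intLattice (block_injective k d j) (hV y hy)

theorem mul_latticeWidth_le_wp {d k : ℕ} (hk : 0 < k) {V : Set (Fin d → ℝ)} (hfin : V.Finite)
    (hV : ∀ y ∈ V, (k : ℝ) • y ∈ intLattice d) (h0 : (0 : Fin d → ℝ) ∈ V)
    (hint : (interior (convexHull ℝ V)).Nonempty) (hhol : IsHollow (convexHull ℝ V)) :
    (k : ℝ≥0∞) * latticeWidth (convexHull ℝ V) ≤ wp (k * d) := by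
  have hk' : (k : ℝ) ≠ 0 := by exact_mod_cast hk.ne'
  refine (mul_latticeWidth_le_directSum (k := k) V).trans (latticeWidth_le_wp
    (isLatticePolytope_convexHull (Set.finite_iUnion fun j => hfin.image _)
      (directSum_subset_intLattice hV) (interior_directSum_nonempty hk hk hint))
    (isHollow_directSum hk hk h0 hint ?_))
  rwa [div_self hk', one_smul]

theorem mul_latticeWidth_le_ws {d k D : ℕ} (hk : 0 < k) (hD : 0 < D)
    {v : Fin (d + 1) → (Fin d → ℝ)} (hv : ∀ i, v i ∈ intLattice d) (h0 : v 0 = 0)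
    (hint : (interior (convexHull ℝ (Set.range v))).Nonempty)
    (hhol : IsHollow (((D : ℝ) / k) • convexHull ℝ (Set.range v))) :
    (D : ℝ≥0∞) * latticeWidth (convexHull ℝ (Set.range v)) ≤ ws (k * d) := by
  have h0' : (0 : Fin d → ℝ) ∈ Set.range v := ⟨0, h0⟩
  -- All copies share the vertex 0, so the sum has only `k * d + 1` vertices and is again a simplex.
  have hr : Set.range (Fin.cons 0 (fun i => (D : ℝ) •
      coordEmb (block k d (finProdFinEquiv.symm i).1) (v (finProdFinEquiv.symm i).2.succ)) :
      Fin (k * d + 1) → (Fin (k * d) → ℝ)) = directSum k (Set.range v) D := by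
    rw [Fin.range_cons]
    refine Set.Subset.antisymm (Set.insert_subset ?_ ?_) (Set.iUnion_subset fun j => ?_)
    · exact Set.mem_iUnion.2 ⟨⟨0, hk⟩, 0, h0', by simp⟩
    · rintro _ ⟨i, rfl⟩
      exact Set.mem_iUnion.2 ⟨_, _, ⟨_, rfl⟩, rfl⟩
    · rintro _ ⟨_, ⟨i, rfl⟩, rfl⟩
      refine Fin.cases ?_ (fun l => ?_) i
      · simp [h0]
      · exact Set.mem_insert_of_mem _ ⟨finProdFinEquiv (j, l), by simp⟩
  refine (mul_latticeWidth_le_directSum (k := k) _).trans (latticeWidth_le_ws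
    (isLatticeSimplex_iff.2 ⟨_, fun i => ?_, by rw [hr], interior_directSum_nonempty hk hD hint⟩)
    (isHollow_directSum hk hD h0' hint hhol))
  refine directSum_subset_intLattice (V := Set.range v) (k := k) (D := D) ?_
    (hr ▸ Set.mem_range_self i)
  rintro _ ⟨l, rfl⟩ m
  obtain ⟨n, hn⟩ := hv l m
  exact ⟨D * n, by simp [hn]⟩

/-! ### Approximation of convex bodies by rational polytopes. -/

/-- Points with rational coordinates. -/
def ratPoints (d : ℕ) : Set (Fin d → ℝ) := {x | ∀ i, ∃ q : ℚ, x i = q}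

theorem intLattice_subset_ratPoints (d : ℕ) : intLattice d ⊆ ratPoints d := fun x hx i => by
  obtain ⟨n, hn⟩ := hx i
  exact ⟨n, by simp [hn]⟩

theorem ratPoints_add {d : ℕ} {x y : Fin d → ℝ} (hx : x ∈ ratPoints d) (hy : y ∈ ratPoints d) :
    x + y ∈ ratPoints d := fun i => by
  obtain ⟨a, ha⟩ := hx i
  obtain ⟨b, hb⟩ := hy i
  exact ⟨a + b, by simp [ha, hb]⟩

theorem natCast_smul_mem_intLattice {d : ℕ} {x : Fin d → ℝ} (hx : x ∈ intLattice d) (n : ℕ) :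
    (n : ℝ) • x ∈ intLattice d := fun i => by
  obtain ⟨a, ha⟩ := hx i
  exact ⟨n * a, by simp [ha]⟩

theorem exists_natCast_smul_mem_intLattice {d : ℕ} {x : Fin d → ℝ} (hx : x ∈ ratPoints d) :
    ∃ m : ℕ, 0 < m ∧ (m : ℝ) • x ∈ intLattice d := by
  choose q hq using hx
  refine ⟨∏ i, (q i).den, Finset.prod_pos fun i _ => (q i).den_pos, fun i => ?_⟩
  obtain ⟨n, hn⟩ := Finset.dvd_prod_of_mem (fun i => (q i).den) (Finset.mem_univ i)
  refine ⟨n * (q i).num, ?_⟩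
  rw [hn, Pi.smul_apply, hq, smul_eq_mul]
  have h : ((q i).den : ℝ) * (q i : ℝ) = (q i).num := by exact_mod_cast Rat.den_mul_eq_num (q i)
  push_cast
  rw [← h]
  ring

theorem exists_common_denominator {d : ℕ} {V : Set (Fin d → ℝ)} (hfin : V.Finite)
    (hV : V ⊆ ratPoints d) : ∃ m : ℕ, 0 < m ∧ ∀ y ∈ V, (m : ℝ) • y ∈ intLattice d := by
  induction V, hfin using Set.Finite.induction_on with
  | empty => exact ⟨1, one_pos, by simp⟩
  | @insert x s _ _ ih =>
    obtain ⟨m, hm, hms⟩ := ih ((Set.subset_insert _ _).trans hV)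
    obtain ⟨n, hn, hnx⟩ := exists_natCast_smul_mem_intLattice (hV (Set.mem_insert x s))
    refine ⟨m * n, Nat.mul_pos hm hn, ?_⟩
    rintro y (rfl | hy)
    · rw [Nat.cast_mul, mul_smul]
      exact natCast_smul_mem_intLattice hnx m
    · rw [Nat.cast_mul, mul_comm, mul_smul]
      exact natCast_smul_mem_intLattice (hms y hy) n

theorem exists_rat_convexHull_nhds {d : ℕ} {O : Set (Fin d → ℝ)} (hO : IsOpen O)
    {x : Fin d → ℝ} (hx : x ∈ O) :
    ∃ V : Set (Fin d → ℝ), V.Finite ∧ V ⊆ ratPoints d ∧ V ⊆ O ∧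
      x ∈ interior (convexHull ℝ V) := by
  obtain ⟨ε, hε, hball⟩ := Metric.isOpen_iff.1 hO x hx
  choose a ha using fun i => exists_rat_btwn (show x i - ε < x i by linarith)
  choose b hb using fun i => exists_rat_btwn (show x i < x i + ε by linarith)
  let V : Set (Fin d → ℝ) := Set.univ.pi fun i => {(a i : ℝ), (b i : ℝ)}
  have hVc : convexHull ℝ V = Set.univ.pi fun i => Set.Icc (a i : ℝ) (b i) := by
    rw [convexHull_pi]
    congr 1
    ext1 i
    rw [convexHull_pair, segment_eq_Icc ((ha i).2.trans (hb i).1).le]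
  refine ⟨V, Set.Finite.pi fun i => Set.toFinite _, fun y hy i => ?_, fun y hy => hball ?_, ?_⟩
  · rcases hy i (Set.mem_univ i) with h | h
    · exact ⟨a i, h⟩
    · exact ⟨b i, h⟩
  · rw [Metric.mem_ball, dist_pi_lt_iff hε]
    intro i
    rw [Real.dist_eq, abs_lt]
    have h1 := ha i
    have h2 := hb i
    rcases hy i (Set.mem_univ i) with h | h
    · rw [h]
      constructor <;> linarith
    · rw [Set.mem_singleton_iff.1 h]
      constructor <;> linarith
  · rw [hVc]
    exact interior_maximal (Set.pi_mono fun i _ => Set.Ioo_subset_Icc_self)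
      (isOpen_set_pi Set.finite_univ fun i _ => isOpen_Ioo) fun i _ => ⟨(ha i).2, (hb i).1⟩

/-- Finitely many small rational boxes cover `C`. Only their corners are claimed to lie in `O`; the
hull is controlled later by the convexity of a larger set. -/
theorem exists_rat_convexHull_of_isCompact {d : ℕ} {O C : Set (Fin d → ℝ)} (hO : IsOpen O)
    (hC : IsCompact C) (hCO : C ⊆ O) :
    ∃ V : Set (Fin d → ℝ), V.Finite ∧ V ⊆ ratPoints d ∧ V ⊆ O ∧
      C ⊆ interior (convexHull ℝ V) := by
  refine hC.induction_on (p := fun s => ∃ V : Set (Fin d → ℝ), V.Finite ∧ V ⊆ ratPoints d ∧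
    V ⊆ O ∧ s ⊆ interior (convexHull ℝ V)) ⟨∅, by simp⟩ ?_ ?_ ?_
  · rintro s t hst ⟨V, h1, h2, h3, h4⟩
    exact ⟨V, h1, h2, h3, hst.trans h4⟩
  · rintro s t ⟨V, h1, h2, h3, h4⟩ ⟨W, g1, g2, g3, g4⟩
    exact ⟨V ∪ W, h1.union g1, Set.union_subset h2 g2, Set.union_subset h3 g3,
      Set.union_subset (h4.trans (interior_mono (convexHull_mono Set.subset_union_left)))
        (g4.trans (interior_mono (convexHull_mono Set.subset_union_right)))⟩
  · intro x hx
    obtain ⟨V, h1, h2, h3, h4⟩ := exists_rat_convexHull_nhds hO (hCO hx)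
    exact ⟨_, mem_nhdsWithin_of_mem_nhds (isOpen_interior.mem_nhds h4), V, h1, h2, h3, subset_rfl⟩

theorem finite_intLattice_inter_closedBall (d : ℕ) (R : ℝ) :
    (intLattice d ∩ Metric.closedBall 0 R).Finite := by
  refine ((Set.finite_Icc (fun _ : Fin d => -⌈R⌉) (fun _ => ⌈R⌉)).image
    fun z i => (z i : ℝ)).subset ?_
  rintro x ⟨hx, hR⟩
  choose z hz using hx
  have h (i : Fin d) : |(z i : ℝ)| ≤ ⌈R⌉ := by
    rw [← hz, ← Real.norm_eq_abs]
    exact (norm_le_pi_norm x i).trans ((mem_closedBall_zero_iff.1 hR).trans (Int.le_ceil R))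
  refine ⟨z, ⟨fun i => ?_, fun i => ?_⟩, funext fun i => (hz i).symm⟩
  · exact_mod_cast (abs_le.1 (h i)).1
  · exact_mod_cast (abs_le.1 (h i)).2

/-- A hollow body may contain no lattice point, while direct sums need one in common. Dilate about
an interior point `c` until the boundary first meets the lattice: the factor is the least gauge
value at a lattice point, and hollowness makes it at least 1. -/
theorem exists_hollow_dilation {d : ℕ} {K : Set (Fin d → ℝ)} (hK : IsConvexBody K)
    (hh : IsHollow K) : ∃ S : Set (Fin d → ℝ), Convex ℝ S ∧ IsHollow S ∧ K ⊆ S ∧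
      ∃ p ∈ S, p ∈ intLattice d := by
  obtain ⟨hconv, hcomp, c, hc⟩ := hK
  set K₀ := -c +ᵥ K with hK₀
  have hconv₀ : Convex ℝ K₀ := hconv.vadd _
  have hint₀ : interior K₀ = -c +ᵥ interior K := interior_vadd _ _
  have hnhds : K₀ ∈ 𝓝 (0 : Fin d → ℝ) := by
    rw [mem_interior_iff_mem_nhds.symm, hint₀, Set.mem_vadd_set_iff_neg_vadd_mem]
    simpa using hc
  have hclosed : IsClosed K₀ := hcomp.isClosed.vadd _
  have hbdd : Bornology.IsBounded K₀ := (hcomp.vadd _).isBounded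
  obtain ⟨R, hR, hKR⟩ : ∃ R > 0, K₀ ⊆ Metric.closedBall 0 R := by
    obtain ⟨R, hR⟩ := hbdd.subset_closedBall 0
    exact ⟨max R 1, by positivity, hR.trans (Metric.closedBall_subset_closedBall (le_max_left _ _))⟩
  let g : (Fin d → ℝ) → ℝ := fun x => gauge K₀ (x - c)
  -- Only lattice points that do no worse than the origin compete, and boundedness of `K₀` leaves
  -- finitely many.
  have hfin : {x | x ∈ intLattice d ∧ g x ≤ g 0}.Finite := by
    refine (finite_intLattice_inter_closedBall d (g 0 * R + ‖c‖)).subset ?_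
    rintro x ⟨hx, hgx⟩
    refine ⟨hx, mem_closedBall_zero_iff.2 ?_⟩
    have h1 := le_gauge_of_subset_closedBall (x := x - c) (absorbent_nhds_zero hnhds) hR.le hKR
    rw [div_le_iff₀ hR] at h1
    have h2 : ‖x‖ ≤ ‖x - c‖ + ‖c‖ := by simpa using norm_add_le (x - c) c
    have h3 : gauge K₀ (x - c) * R ≤ g 0 * R := mul_le_mul_of_nonneg_right hgx hR.le
    linarith
  obtain ⟨p, ⟨hp, -⟩, hmin⟩ := Set.exists_min_image _ g hfin ⟨0, zero_mem_intLattice d, le_rfl⟩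
  have hmin' : ∀ x ∈ intLattice d, g p ≤ g x := fun x hx => by
    rcases le_total (g x) (g 0) with h | h
    · exact hmin x ⟨hx, h⟩
    · exact (hmin 0 ⟨zero_mem_intLattice d, le_rfl⟩).trans h
  have ht : 1 ≤ g p := by
    by_contra! hlt
    have h1 := (gauge_lt_one_iff_mem_interior hconv₀ hnhds).1 hlt
    rw [hint₀, Set.mem_vadd_set_iff_neg_vadd_mem] at h1
    refine Set.eq_empty_iff_forall_notMem.1 hh p ⟨?_, hp⟩
    simpa using h1
  set t := g p with htdef
  have ht0 : 0 < t := by linarith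
  have hinv (x : Fin d → ℝ) : gauge K₀ (t⁻¹ • (x - c)) = t⁻¹ * g x := by
    rw [gauge_smul_of_nonneg (by positivity), smul_eq_mul]
  refine ⟨c +ᵥ t • K₀, (hconv₀.smul t).vadd c, ?_, ?_, p, ?_, hp⟩
  · rw [IsHollow, Set.eq_empty_iff_forall_notMem]
    rintro x ⟨hx, hxl⟩
    rw [interior_vadd, interior_smul₀ ht0.ne', Set.mem_vadd_set_iff_neg_vadd_mem,
      Set.mem_smul_set_iff_inv_smul_mem₀ ht0.ne', vadd_eq_add, neg_add_eq_sub,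
      ← gauge_lt_one_iff_mem_interior hconv₀ hnhds, hinv, inv_mul_lt_one₀ ht0] at hx
    exact absurd (hmin' x hxl) (not_le.2 hx)
  · intro x hx
    rw [Set.mem_vadd_set_iff_neg_vadd_mem, ← one_smul ℝ (-c +ᵥ x)]
    exact smul_subset_smul_of_le hconv₀ (mem_of_mem_nhds hnhds) zero_le_one ht0 ht
      (Set.smul_mem_smul_set (Set.vadd_mem_vadd_set hx))
  · rw [Set.mem_vadd_set_iff_neg_vadd_mem, Set.mem_smul_set_iff_inv_smul_mem₀ ht0.ne',
      vadd_eq_add, neg_add_eq_sub, ← hclosed.closure_eq,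
      ← gauge_le_one_iff_mem_closure hconv₀ hnhds, hinv, inv_mul_cancel₀ ht0.ne']

theorem exists_mul_latticeWidth_le_wp {d : ℕ} {K : Set (Fin d → ℝ)} (hK : IsConvexBody K)
    (hh : IsHollow K) {r : ℝ≥0} (hr : r < 1) :
    ∃ m : ℕ, 0 < m ∧ ∀ q : ℕ, 0 < q →
      (q : ℝ≥0∞) * (m * (r * latticeWidth K)) ≤ wp (q * (m * d)) := by
  obtain ⟨S, hSconv, hShol, hKS, p, hpS, hp⟩ := exists_hollow_dilation hK hh
  obtain ⟨hconv, hcomp, c, hc⟩ := hK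
  have hr' : (r : ℝ) < 1 := hr
  -- Shrinking about `c` costs a factor `r` in width and makes room for a rational polytope between
  -- `C` and `S`. Adjoining the lattice point `p` keeps it inside `S`, hence hollow.
  let C : Set (Fin d → ℝ) := (fun y => (1 - (r : ℝ)) • c + (r : ℝ) • y) '' K
  have hCK : C ⊆ interior S := by
    rintro _ ⟨y, hy, rfl⟩
    exact interior_mono hKS (hconv.combo_interior_self_mem_interior hc hy (by linarith) r.2
      (by ring))
  obtain ⟨V, hfin, hrat, hVS, hCV⟩ := exists_rat_convexHull_of_isCompact isOpen_interior
    (hcomp.image (by fun_prop) : IsCompact C) hCK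
  have hcC : c ∈ C := ⟨c, interior_subset hc, by simp [← add_smul]⟩
  have hhull : convexHull ℝ (-p +ᵥ insert p V) = -p +ᵥ convexHull ℝ (insert p V) :=
    convexHull_vadd _ _
  have hfin' : (-p +ᵥ insert p V).Finite := (hfin.insert p).vadd_set
  obtain ⟨m, hm, hmV⟩ := exists_common_denominator hfin' (by
    rintro _ ⟨x, hx, rfl⟩
    refine ratPoints_add (intLattice_subset_ratPoints d (intLattice_neg hp)) ?_
    rcases hx with rfl | hx
    · exact intLattice_subset_ratPoints d hp
    · exact hrat hx)
  refine ⟨m, hm, fun q hq => ?_⟩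
  have h1 := mul_latticeWidth_le_wp (k := q * m) (Nat.mul_pos hq hm) hfin' (fun y hy => ?_)
    (by simpa using Set.vadd_mem_vadd_set (a := -p) (Set.mem_insert p V)) ?_ ?_
  · rw [← mul_assoc, ← mul_assoc q m d, ← Nat.cast_mul]
    refine le_trans (mul_le_mul_right ?_ _) h1
    rw [hhull]
    refine le_trans ?_ (latticeWidth_le_vadd _ _)
    refine mul_latticeWidth_le r ((1 - (r : ℝ)) • c) fun y hy => ?_
    exact convexHull_mono (Set.subset_insert p V) (interior_subset (hCV ⟨y, hy, rfl⟩))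
  · rw [Nat.cast_mul, mul_smul]
    exact natCast_smul_mem_intLattice (hmV y hy) q
  · rw [hhull, interior_vadd]
    exact (Set.Nonempty.mono (interior_mono (convexHull_mono (Set.subset_insert p V)))
      ⟨c, hCV hcC⟩).vadd_set
  · rw [hhull]
    exact (hShol.mono (convexHull_min (Set.insert_subset hpS (hVS.trans interior_subset))
      hSconv)).vadd (intLattice_neg hp)

theorem wc_div_le_liminf {d : ℕ} (hd : d ≠ 0) :
    wc d / d ≤ liminf (fun n : ℕ => wp n / (n : ℝ≥0∞)) atTop := by
  rw [ENNReal.div_le_iff_le_mul (by simp [hd]) (by simp)]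
  refine iSup_le fun K => iSup₂_le fun hK hh => ?_
  rw [← ENNReal.div_le_iff_le_mul (by simp [hd]) (by simp)]
  have h (r : ℝ≥0) (hr : r < 1) : (r : ℝ≥0∞) * (latticeWidth K / d) ≤
      liminf (fun n : ℕ => wp n / (n : ℝ≥0∞)) atTop := by
    obtain ⟨m, hm, hmw⟩ := exists_mul_latticeWidth_le_wp hK hh hr
    have h1 := div_le_liminf (monotone_nat_of_le_succ wp_le_succ)
      (Nat.mul_ne_zero hm.ne' hd) (fun q hq => hmw q (Nat.pos_of_ne_zero hq))
    rw [Nat.cast_mul, ENNReal.mul_div_mul_left _ _ (by simp [hm.ne']) (by simp)] at h1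
    rwa [← mul_div_assoc]
  refine ENNReal.le_of_forall_lt_one_mul_le fun a ha => ?_
  lift a to ℝ≥0 using ha.ne_top
  exact h a (by exact_mod_cast ha)

/-! ### The tetrahedron in dimension 3. -/

/-- A closed half-space of `ℝ³`. -/
def halfSpace (α β γ δ : ℝ) : Set (Fin 3 → ℝ) := {x | 0 ≤ α * x 0 + β * x 1 + γ * x 2 + δ}

theorem convex_halfSpace (α β γ δ : ℝ) : Convex ℝ (halfSpace α β γ δ) := by
  intro x hx y hy a b ha hb hab
  have hx : 0 ≤ α * x 0 + β * x 1 + γ * x 2 + δ := hx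
  have hy : 0 ≤ α * y 0 + β * y 1 + γ * y 2 + δ := hy
  have h := add_nonneg (mul_nonneg ha hx) (mul_nonneg hb hy)
  change 0 ≤ α * (a * x 0 + b * y 0) + β * (a * x 1 + b * y 1) + γ * (a * x 2 + b * y 2) + δ
  refine h.trans_eq ?_
  linear_combination δ * hab

theorem isClosed_halfSpace (α β γ δ : ℝ) : IsClosed (halfSpace α β γ δ) :=
  isClosed_le continuous_const (by fun_prop)

theorem isOpen_strictHalfSpace (α β γ δ : ℝ) :
    IsOpen {x : Fin 3 → ℝ | 0 < α * x 0 + β * x 1 + γ * x 2 + δ} :=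
  isOpen_lt continuous_const (by fun_prop)

/-- A small step along `-u` stays in `K` and strictly decreases `f`. -/
theorem lt_of_mem_interior {d : ℕ} {K : Set (Fin d → ℝ)} {f : Module.Dual ℝ (Fin d → ℝ)} {c : ℝ}
    (hK : ∀ y ∈ K, c ≤ f y) {u : Fin d → ℝ} (hu : 0 < f u) {x : Fin d → ℝ}
    (hx : x ∈ interior K) : c < f x := by
  have hcont : Tendsto (fun t : ℝ => x - t • u) (𝓝[>] 0) (𝓝 x) := by
    have : Continuous (fun t : ℝ => x - t • u) := by fun_prop
    have h := this.tendsto 0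
    rw [zero_smul, sub_zero] at h
    exact h.mono_left nhdsWithin_le_nhds
  obtain ⟨t, htS, ht⟩ := ((hcont.eventually (isOpen_interior.mem_nhds hx)).and
    self_mem_nhdsWithin).exists
  have h := hK _ (interior_subset htS)
  rw [map_sub, map_smul, smul_eq_mul] at h
  have : 0 < t * f u := mul_pos ht hu
  linarith

theorem pos_of_mem_interior_halfSpace {α β γ δ : ℝ} (hα : α ≠ 0) {x : Fin 3 → ℝ}
    (hx : x ∈ interior (halfSpace α β γ δ)) : 0 < α * x 0 + β * x 1 + γ * x 2 + δ := by
  have h := lt_of_mem_interior (K := halfSpace α β γ δ) (c := -δ)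
    (f := α • LinearMap.proj 0 + β • LinearMap.proj 1 + γ • LinearMap.proj 2)
    (fun y (hy : 0 ≤ α * y 0 + β * y 1 + γ * y 2 + δ) => by simp; linarith)
    (u := Pi.single 0 α) (by simpa using mul_self_pos.2 hα) hx
  simp at h
  linarith

theorem sqrt_two_bounds : Real.sqrt 2 ^ 2 = 2 ∧ 1.414 < Real.sqrt 2 ∧ Real.sqrt 2 < 1.415 :=
  ⟨Real.sq_sqrt (by norm_num), Real.lt_sqrt_of_sq_lt (by norm_num),
    (Real.sqrt_lt' (by norm_num)).2 (by norm_num)⟩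

/-- A hollow tetrahedron of lattice width `2 + √2`. -/
noncomputable def tetrahedron : Set (Fin 3 → ℝ) :=
  halfSpace 1 √2 (3 - √2) 0 ∩ halfSpace (√2 - 3) (√2 - 2) (2 * √2 - 3) (3 - √2) ∩
    halfSpace (3 - 2 * √2) (-√2) (1 - √2) √2 ∩ halfSpace (√2 - 1) (2 - √2) (-1) 1

theorem mem_tetrahedron {x : Fin 3 → ℝ} : x ∈ tetrahedron ↔
    0 ≤ 1 * x 0 + √2 * x 1 + (3 - √2) * x 2 + 0 ∧
    0 ≤ (√2 - 3) * x 0 + (√2 - 2) * x 1 + (2 * √2 - 3) * x 2 + (3 - √2) ∧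
    0 ≤ (3 - 2 * √2) * x 0 + -√2 * x 1 + (1 - √2) * x 2 + √2 ∧
    0 ≤ (√2 - 1) * x 0 + (2 - √2) * x 1 + -1 * x 2 + 1 := by
  simp only [tetrahedron, halfSpace, Set.mem_inter_iff, Set.mem_ofPred_eq, and_assoc]

theorem abs_lt_two_of_mem_tetrahedron {x : Fin 3 → ℝ} (hx : x ∈ tetrahedron) (i : Fin 3) :
    |x i| < 2 := by
  obtain ⟨hr, h1, h2⟩ := sqrt_two_bounds
  obtain ⟨g0, g1, g2, g3⟩ := mem_tetrahedron.1 hx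
  generalize √2 = r at *
  -- The facet forms are four times the barycentric coordinates; `e0`, `e1`, `e2` express `x`
  -- through the vertices, whose coordinates are at most `3 * (1 + √2) / 4 < 2` in absolute value.
  have hs : (1 * x 0 + r * x 1 + (3 - r) * x 2 + 0) +
    ((r - 3) * x 0 + (r - 2) * x 1 + (2 * r - 3) * x 2 + (3 - r)) +
    ((3 - 2 * r) * x 0 + -r * x 1 + (1 - r) * x 2 + r) +
    ((r - 1) * x 0 + (2 - r) * x 1 + -1 * x 2 + 1) = 4 := by ring
  set y := 1 - x 0 - x 1 - x 2 with hy
  have e0 : 16 * x 0 = (1 + r) * (1 * x 0 + r * x 1 + (3 - r) * x 2 + 0) -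
    (3 + 3 * r) * ((r - 3) * x 0 + (r - 2) * x 1 + (2 * r - 3) * x 2 + (3 - r)) +
    (5 + r) * ((3 - 2 * r) * x 0 + -r * x 1 + (1 - r) * x 2 + r) +
    (1 + r) * ((r - 1) * x 0 + (2 - r) * x 1 + -1 * x 2 + 1) := by
    linear_combination (-4 * (y - x 2)) * hr
  have e1 : 16 * x 1 = (1 + r) * (1 * x 0 + r * x 1 + (3 - r) * x 2 + 0) +
    (1 + r) * ((r - 3) * x 0 + (r - 2) * x 1 + (2 * r - 3) * x 2 + (3 - r)) -
    (3 + 3 * r) * ((3 - 2 * r) * x 0 + -r * x 1 + (1 - r) * x 2 + r) +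
    (5 + r) * ((r - 1) * x 0 + (2 - r) * x 1 + -1 * x 2 + 1) := by
    linear_combination (-4 * (x 0 - y)) * hr
  have e2 : 16 * x 2 = (5 + r) * (1 * x 0 + r * x 1 + (3 - r) * x 2 + 0) +
    (1 + r) * ((r - 3) * x 0 + (r - 2) * x 1 + (2 * r - 3) * x 2 + (3 - r)) +
    (1 + r) * ((3 - 2 * r) * x 0 + -r * x 1 + (1 - r) * x 2 + r) -
    (3 + 3 * r) * ((r - 1) * x 0 + (2 - r) * x 1 + -1 * x 2 + 1) := by
    linear_combination (-4 * (x 1 - x 0)) * hr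
  generalize 1 * x 0 + r * x 1 + (3 - r) * x 2 + 0 = a at *
  generalize (r - 3) * x 0 + (r - 2) * x 1 + (2 * r - 3) * x 2 + (3 - r) = b at *
  generalize (3 - 2 * r) * x 0 + -r * x 1 + (1 - r) * x 2 + r = c at *
  generalize (r - 1) * x 0 + (2 - r) * x 1 + -1 * x 2 + 1 = d at *
  have ha : 0 ≤ r * a ∧ r * a ≤ 1.415 * a := ⟨by positivity, by gcongr⟩
  have hb : 0 ≤ r * b ∧ r * b ≤ 1.415 * b := ⟨by positivity, by gcongr⟩
  have hc : 0 ≤ r * c ∧ r * c ≤ 1.415 * c := ⟨by positivity, by gcongr⟩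
  have hd : 0 ≤ r * d ∧ r * d ≤ 1.415 * d := ⟨by positivity, by gcongr⟩
  fin_cases i <;> simp only [abs_lt] <;> constructor <;> simp <;> nlinarith

theorem isConvexBody_tetrahedron : IsConvexBody tetrahedron := by
  obtain ⟨hr, h1, h2⟩ := sqrt_two_bounds
  refine ⟨(((convex_halfSpace _ _ _ _).inter (convex_halfSpace _ _ _ _)).inter
    (convex_halfSpace _ _ _ _)).inter (convex_halfSpace _ _ _ _), ?_, ?_⟩
  · refine Metric.isCompact_of_isClosed_isBounded (((((isClosed_halfSpace _ _ _ _).inter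
      (isClosed_halfSpace _ _ _ _)).inter (isClosed_halfSpace _ _ _ _)).inter
      (isClosed_halfSpace _ _ _ _))) ((Metric.isBounded_closedBall (x := 0) (r := 2)).subset ?_)
    intro x hx
    rw [mem_closedBall_zero_iff, pi_norm_le_iff_of_nonneg zero_le_two]
    exact fun i => (abs_lt_two_of_mem_tetrahedron hx i).le
  · let U : Set (Fin 3 → ℝ) := {x | 0 < 1 * x 0 + √2 * x 1 + (3 - √2) * x 2 + 0 ∧
      0 < (√2 - 3) * x 0 + (√2 - 2) * x 1 + (2 * √2 - 3) * x 2 + (3 - √2) ∧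
      0 < (3 - 2 * √2) * x 0 + -√2 * x 1 + (1 - √2) * x 2 + √2 ∧
      0 < (√2 - 1) * x 0 + (2 - √2) * x 1 + -1 * x 2 + 1}
    have hU : IsOpen U := (isOpen_strictHalfSpace _ _ _ _).inter
      ((isOpen_strictHalfSpace _ _ _ _).inter
        ((isOpen_strictHalfSpace _ _ _ _).inter (isOpen_strictHalfSpace _ _ _ _)))
    refine ⟨fun _ => 1 / 4, interior_maximal (fun x hx => mem_tetrahedron.2
      ⟨hx.1.le, hx.2.1.le, hx.2.2.1.le, hx.2.2.2.le⟩) hU ⟨?_, ?_, ?_, ?_⟩⟩ <;> linarith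

theorem isHollow_tetrahedron : IsHollow tetrahedron := by
  obtain ⟨hr, h1, h2⟩ := sqrt_two_bounds
  rw [IsHollow, Set.eq_empty_iff_forall_notMem]
  rintro x ⟨hx, hxl⟩
  have habs := abs_lt_two_of_mem_tetrahedron (interior_subset hx)
  simp only [tetrahedron, interior_inter] at hx
  obtain ⟨⟨⟨g0, g1⟩, g2⟩, g3⟩ := hx
  replace g0 := pos_of_mem_interior_halfSpace one_ne_zero g0
  replace g1 := pos_of_mem_interior_halfSpace (by linarith) g1
  replace g2 := pos_of_mem_interior_halfSpace (by linarith) g2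
  replace g3 := pos_of_mem_interior_halfSpace (by linarith) g3
  choose z hz using hxl
  simp only [hz] at *
  -- This leaves 27 candidates, each excluded by the strict facet inequalities.
  have hz2 (i : Fin 3) : -1 ≤ z i ∧ z i ≤ 1 := by
    have h : |z i| < 2 := by exact_mod_cast habs i
    rw [abs_lt] at h
    constructor <;> linarith
  obtain ⟨a1, a2⟩ := hz2 0
  obtain ⟨b1, b2⟩ := hz2 1
  obtain ⟨c1, c2⟩ := hz2 2
  generalize z 0 = a at *
  generalize z 1 = b at *
  generalize z 2 = c at *
  clear habs hz hz2
  interval_cases a <;> interval_cases b <;> interval_cases c <;> push_cast at g0 g1 g2 g3 <;>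
    linarith

theorem apply_eq_sum_single {d : ℕ} (f : Module.Dual ℝ (Fin d → ℝ)) (x : Fin d → ℝ) :
    f x = ∑ i, x i * f (Pi.single i 1) := by
  conv_lhs => rw [pi_eq_sum_univ' x]
  simp [map_sum, Pi.single]

theorem single_mem_intLattice {d : ℕ} (i : Fin d) :
    (Pi.single i 1 : Fin d → ℝ) ∈ intLattice d := fun j => by
  by_cases h : j = i
  · subst h
    exact ⟨1, by simp⟩
  · exact ⟨0, by simp [h]⟩

theorem IsLatticeFunctional.exists_int {d : ℕ} {f : Module.Dual ℝ (Fin d → ℝ)}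
    (hf : IsLatticeFunctional f) (hf0 : f ≠ 0) :
    ∃ n : Fin d → ℤ, n ≠ 0 ∧ ∀ x, f x = ∑ i, x i * n i := by
  choose n hn using fun i => hf _ (single_mem_intLattice i)
  refine ⟨n, ?_, fun x => ?_⟩
  · rintro rfl
    refine hf0 (LinearMap.ext fun x => ?_)
    rw [apply_eq_sum_single]
    simp [hn]
  · rw [apply_eq_sum_single]
    simp [hn]

/-- The hypotheses bound the differences of the functional `(a, b, c)` between vertices. Nonnegative
combinations of them isolate each coefficient and give absolute value below 2, so integrality leaves
a finite check. -/
theorem tetrahedron_integer_forms {a b c : ℤ} {r : ℝ} (hr : r ^ 2 = 2) (h1 : 1.414 < r)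
    (h2 : r < 1.415)
    (h01 : (1 + r) * a + c < 2 + r) (h10 : -((1 + r) * a + c) < 2 + r)
    (h02 : -a + (1 + r) * b + c < 2 + r) (h20 : -(-a + (1 + r) * b + c) < 2 + r)
    (h03 : -b + (2 + r) * c < 2 + r) (h30 : -(-b + (2 + r) * c) < 2 + r)
    (h12 : -(2 + r) * a + (1 + r) * b < 2 + r) (h21 : -(-(2 + r) * a + (1 + r) * b) < 2 + r)
    (h13 : -(1 + r) * a - b + (1 + r) * c < 2 + r)
    (h31 : -(-(1 + r) * a - b + (1 + r) * c) < 2 + r)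
    (h23 : a - (2 + r) * b + (1 + r) * c < 2 + r)
    (h32 : -(a - (2 + r) * b + (1 + r) * c) < 2 + r) : a = 0 ∧ b = 0 ∧ c = 0 := by
  have p1 : 0 < 3 - 2 * r := by linarith
  have p2 : 0 < r - 1 := by linarith
  have p3 : 0 < 2 - r := by linarith
  have p4 : 0 < r := by linarith
  have key {u v w t : ℝ} (hu : u < 2 + r) (hv : v < 2 + r) (hw : w < 2 + r)
      (ht : 4 * t = (3 - 2 * r) * u + (r - 1) * v + w) : t < 2 := by
    nlinarith [mul_pos p1 (sub_pos.2 hu), mul_pos p2 (sub_pos.2 hv)]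
  have key' {u v t : ℝ} (hu : u < 2 + r) (hv : v < 2 + r)
      (ht : 4 * t = r * u + (2 - r) * v) : t < 2 := by
    nlinarith [mul_pos p4 (sub_pos.2 hu), mul_pos p3 (sub_pos.2 hv)]
  have ha : (a : ℝ) < 2 := key h21 h31 h01 (by linear_combination (a - 2 * b + c) * hr)
  have ha' : -(a : ℝ) < 2 := key h12 h13 h10 (by linear_combination (-a + 2 * b - c) * hr)
  have hb : (b : ℝ) < 2 := key' h02 h31 (by linear_combination (a - b - c) * hr)
  have hb' : -(b : ℝ) < 2 := key' h20 h13 (by linear_combination (-a + b + c) * hr)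
  have hc : (c : ℝ) < 2 := key h01 h02 h03 (by linear_combination (2 * a - b) * hr)
  have hc' : -(c : ℝ) < 2 := key h10 h20 h30 (by linear_combination (-2 * a + b) * hr)
  have a1 : a < 2 := by exact_mod_cast ha
  have a2 : -a < 2 := by exact_mod_cast ha'
  have b1 : b < 2 := by exact_mod_cast hb
  have b2 : -b < 2 := by exact_mod_cast hb'
  have c1 : c < 2 := by exact_mod_cast hc
  have c2 : -c < 2 := by exact_mod_cast hc'
  have a3 : -1 ≤ a := by linarith
  have b3 : -1 ≤ b := by linarith
  have c3 : -1 ≤ c := by linarith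
  clear ha ha' hb hb' hc hc' a2 b2 c2 key key'
  interval_cases a <;> interval_cases b <;> interval_cases c <;> push_cast at * <;>
    first
    | (exfalso; linarith)
    | simp

theorem le_latticeWidth_tetrahedron : ENNReal.ofReal (2 + √2) ≤ latticeWidth tetrahedron := by
  obtain ⟨hr, h1, h2⟩ := sqrt_two_bounds
  refine ofReal_le_latticeWidth fun f hf hf0 => ?_
  obtain ⟨n, hn0, hn⟩ := hf.exists_int hf0
  by_contra! h
  -- With fourth coordinate `1 - x 0 - x 1 - x 2`, the vertices are the cyclic shifts of `(P, q, q,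
  -- s)`.
  let q := (1 + √2) / 4
  let P := -(3 + 3 * √2) / 4
  let s := (5 + √2) / 4
  have m0 : ![q, q, s] ∈ tetrahedron := by
    rw [mem_tetrahedron]
    simp only [Matrix.cons_val, q, s]
    refine ⟨?_, ?_, ?_, ?_⟩ <;> nlinarith
  have m1 : ![P, q, q] ∈ tetrahedron := by
    rw [mem_tetrahedron]
    simp only [Matrix.cons_val, q, P]
    refine ⟨?_, ?_, ?_, ?_⟩ <;> nlinarith
  have m2 : ![s, P, q] ∈ tetrahedron := by
    rw [mem_tetrahedron]
    simp only [Matrix.cons_val, q, P, s]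
    refine ⟨?_, ?_, ?_, ?_⟩ <;> nlinarith
  have m3 : ![q, s, P] ∈ tetrahedron := by
    rw [mem_tetrahedron]
    simp only [Matrix.cons_val, q, P, s]
    refine ⟨?_, ?_, ?_, ?_⟩ <;> nlinarith
  have k01 := h _ m0 _ m1
  have k10 := h _ m1 _ m0
  have k02 := h _ m0 _ m2
  have k20 := h _ m2 _ m0
  have k03 := h _ m0 _ m3
  have k30 := h _ m3 _ m0
  have k12 := h _ m1 _ m2
  have k21 := h _ m2 _ m1
  have k13 := h _ m1 _ m3
  have k31 := h _ m3 _ m1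
  have k23 := h _ m2 _ m3
  have k32 := h _ m3 _ m2
  simp only [hn, Fin.sum_univ_three, Matrix.cons_val, q, P, s]
    at k01 k10 k02 k20 k03 k30 k12 k21 k13 k31 k23 k32
  obtain ⟨ha, hb, hc⟩ := tetrahedron_integer_forms (a := n 0) (b := n 1) (c := n 2) hr h1 h2
    (by linarith) (by linarith) (by linarith) (by linarith) (by linarith) (by linarith)
    (by linarith) (by linarith) (by linarith) (by linarith) (by linarith) (by linarith)
  refine hn0 (funext fun i => ?_)
  fin_cases i <;> assumption

theorem le_wc_three : ENNReal.ofReal (2 + √2) ≤ wc 3 :=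
  le_latticeWidth_tetrahedron.trans
    (latticeWidth_le_wc isConvexBody_tetrahedron isHollow_tetrahedron)

/-! ### The empty 4-simplex and its hollow dilation. -/

theorem lt_of_mem_interior_smul_convexHull {d : ℕ} {V : Set (Fin d → ℝ)}
    {f : Module.Dual ℝ (Fin d → ℝ)} {c t : ℝ} (ht : 0 ≤ t) (hV : ∀ y ∈ V, c ≤ f y)
    {u : Fin d → ℝ} (hu : 0 < f u) {x : Fin d → ℝ}
    (hx : x ∈ interior (t • convexHull ℝ V)) : t * c < f x := by
  refine lt_of_mem_interior ?_ hu hx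
  rintro _ ⟨y, hy, rfl⟩
  have h : c ≤ f y := convexHull_min (t := {y | c ≤ f y}) hV
    (convex_halfSpace_ge f.isLinear c) hy
  simp only [map_smul, smul_eq_mul]
  gcongr

/-- The vertices of an empty lattice 4-simplex of normalized volume 101 and width 4. -/
def emptySimplex : Fin 5 → Fin 4 → ℝ :=
  ![![0, 0, 0, 0], ![1, 0, 0, 0], ![0, 1, 0, 0], ![0, 0, 1, 0], ![6, 14, 17, 101]]

theorem emptySimplex_zero : emptySimplex 0 = 0 := by
  ext i
  fin_cases i <;> rfl

theorem emptySimplex_mem_intLattice (i : Fin 5) : emptySimplex i ∈ intLattice 4 := by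
  let w : Fin 5 → Fin 4 → ℤ :=
    ![![0, 0, 0, 0], ![1, 0, 0, 0], ![0, 1, 0, 0], ![0, 0, 1, 0], ![6, 14, 17, 101]]
  intro j
  refine ⟨w i j, ?_⟩
  fin_cases i <;> fin_cases j <;> simp [emptySimplex, w]

theorem interior_emptySimplex_nonempty :
    (interior (convexHull ℝ (Set.range emptySimplex))).Nonempty := by
  let U : Set (Fin 4 → ℝ) := {x | 0 < x 3 ∧ 0 < 101 * x 0 - 6 * x 3 ∧ 0 < 101 * x 1 - 14 * x 3 ∧
    0 < 101 * x 2 - 17 * x 3 ∧ 101 * (x 0 + x 1 + x 2) - 36 * x 3 < 101}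
  have hU : IsOpen U := by
    refine IsOpen.inter (isOpen_lt (f := fun _ => 0) (g := fun x : Fin 4 → ℝ => x 3)
        (by fun_prop) (by fun_prop)) (IsOpen.inter
      (isOpen_lt (f := fun _ => 0) (g := fun x : Fin 4 → ℝ => 101 * x 0 - 6 * x 3)
        (by fun_prop) (by fun_prop)) (IsOpen.inter
      (isOpen_lt (f := fun _ => 0) (g := fun x : Fin 4 → ℝ => 101 * x 1 - 14 * x 3)
        (by fun_prop) (by fun_prop)) (IsOpen.inter
      (isOpen_lt (f := fun _ => 0) (g := fun x : Fin 4 → ℝ => 101 * x 2 - 17 * x 3)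
        (by fun_prop) (by fun_prop))
      (isOpen_lt (f := fun x : Fin 4 → ℝ => 101 * (x 0 + x 1 + x 2) - 36 * x 3)
        (g := fun _ => 101) (by fun_prop) (by fun_prop)))))
  -- The point is the centroid; `U` is where all barycentric coordinates are positive.
  refine ⟨![7 / 5, 3, 18 / 5, 101 / 5], interior_maximal (fun x hx => ?_) hU ?_⟩
  · obtain ⟨h3, h0, h1, h2, h4⟩ := hx
    have hx' : x = ∑ i, (![(101 - (101 * (x 0 + x 1 + x 2) - 36 * x 3)) / 101,
        (101 * x 0 - 6 * x 3) / 101, (101 * x 1 - 14 * x 3) / 101, (101 * x 2 - 17 * x 3) / 101,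
        x 3 / 101] : Fin 5 → ℝ) i • emptySimplex i := by
      ext j
      fin_cases j <;> simp [Fin.sum_univ_five, emptySimplex] <;> ring
    rw [hx']
    refine (convex_convexHull ℝ _).sum_mem (fun i _ => ?_) ?_
      (fun i _ => subset_convexHull ℝ _ (Set.mem_range_self i))
    · fin_cases i <;> simp <;> linarith
    · simp [Fin.sum_univ_five]
      ring
  · refine ⟨?_, ?_, ?_, ?_, ?_⟩ <;> simp <;> norm_num

/-- At lattice points the barycentric coordinates are multiples of 1/101. Dilation about the vertex
0 moves only the opposite facet, so in the interior the coordinate of 0 exceeds -1/101 and is thus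
nonnegative, while the others are positive. Such a point would be a non-vertex lattice point of the
undilated simplex; the final case check finds none. -/
theorem isHollow_smul_emptySimplex :
    IsHollow ((102 / 101 : ℝ) • convexHull ℝ (Set.range emptySimplex)) := by
  rw [IsHollow, Set.eq_empty_iff_forall_notMem]
  rintro x ⟨hx, hxl⟩
  have key (f : Module.Dual ℝ (Fin 4 → ℝ)) (c : ℝ) (h : ∀ i, c ≤ f (emptySimplex i))
      (u : Fin 4 → ℝ) (hu : 0 < f u) : 102 / 101 * c < f x :=
    lt_of_mem_interior_smul_convexHull (by norm_num) (by rintro _ ⟨i, rfl⟩; exact h i) hu hx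
  have h3 := key (LinearMap.proj 3) 0
    (fun i => by fin_cases i <;> simp [emptySimplex]) (Pi.single 3 1) (by simp)
  have h0 := key ((101 : ℝ) • LinearMap.proj 0 - (6 : ℝ) • LinearMap.proj 3) 0
    (fun i => by fin_cases i <;> simp [emptySimplex]; norm_num) (Pi.single 0 1) (by simp)
  have h1 := key ((101 : ℝ) • LinearMap.proj 1 - (14 : ℝ) • LinearMap.proj 3) 0
    (fun i => by fin_cases i <;> simp [emptySimplex]; norm_num) (Pi.single 1 1) (by simp)
  have h2 := key ((101 : ℝ) • LinearMap.proj 2 - (17 : ℝ) • LinearMap.proj 3) 0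
    (fun i => by fin_cases i <;> simp [emptySimplex]; norm_num) (Pi.single 2 1) (by simp)
  have h4 := key ((36 : ℝ) • LinearMap.proj 3 - (101 : ℝ) • LinearMap.proj 0 -
      (101 : ℝ) • LinearMap.proj 1 - (101 : ℝ) • LinearMap.proj 2) (-101)
    (fun i => by fin_cases i <;> simp [emptySimplex]; norm_num) (Pi.single 3 1) (by simp)
  choose z hz using hxl
  simp [hz] at h0 h1 h2 h3 h4
  have g0 : 6 * z 3 < 101 * z 0 := by exact_mod_cast h0
  have g1 : 14 * z 3 < 101 * z 1 := by exact_mod_cast h1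
  have g2 : 17 * z 3 < 101 * z 2 := by exact_mod_cast h2
  have g3 : 0 < z 3 := by exact_mod_cast h3
  have g4 : 101 * (z 0 + z 1 + z 2) < 36 * z 3 + 102 := by
    have : (101 * (z 0 + z 1 + z 2) : ℝ) < 36 * z 3 + 102 := by linarith
    exact_mod_cast this
  generalize z 0 = a at *
  generalize z 1 = b at *
  generalize z 2 = c at *
  generalize z 3 = k at *
  -- Summing `g0`, `g1`, `g2` gives `37 * k + 3 ≤ 101 * (a + b + c)`, while `g4` gives at most `36 *
  -- k + 101`.
  have hk : k ≤ 98 := by omega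
  clear key hz h0 h1 h2 h3 h4
  interval_cases k <;> omega

theorem four_le_latticeWidth_emptySimplex :
    4 ≤ latticeWidth (convexHull ℝ (Set.range emptySimplex)) := by
  have h4 : (4 : ℝ≥0∞) = ENNReal.ofReal 4 := by simp
  rw [h4]
  refine ofReal_le_latticeWidth fun f hf hf0 => ?_
  obtain ⟨n, hn0, hn⟩ := hf.exists_int hf0
  by_contra! h
  have h' (i j : Fin 5) := h _ (subset_convexHull ℝ _ (Set.mem_range_self i)) _
    (subset_convexHull ℝ _ (Set.mem_range_self j))
  let w : Fin 5 → ℤ := ![0, n 0, n 1, n 2, 6 * n 0 + 14 * n 1 + 17 * n 2 + 101 * n 3]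
  have hw (i : Fin 5) : f (emptySimplex i) = w i := by
    rw [hn, Fin.sum_univ_four]
    fin_cases i <;> simp [emptySimplex, w]
  have hd (i j : Fin 5) : w i - w j < 4 := by
    have := h' i j
    rw [hw, hw] at this
    exact_mod_cast this
  have e0 : w 0 = 0 := rfl
  have e1 : w 1 = n 0 := rfl
  have e2 : w 2 = n 1 := rfl
  have e3 : w 3 = n 2 := rfl
  have e4 : w 4 = 6 * n 0 + 14 * n 1 + 17 * n 2 + 101 * n 3 := rfl
  have hne : ¬ (n 0 = 0 ∧ n 1 = 0 ∧ n 2 = 0 ∧ n 3 = 0) := fun ⟨a, b, c, d⟩ =>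
    hn0 (funext fun i => by fin_cases i <;> assumption)
  have d01 := hd 0 1
  have d10 := hd 1 0
  have d02 := hd 0 2
  have d20 := hd 2 0
  have d03 := hd 0 3
  have d30 := hd 3 0
  have d04 := hd 0 4
  have d40 := hd 4 0
  have d12 := hd 1 2
  have d21 := hd 2 1
  have d13 := hd 1 3
  have d31 := hd 3 1
  have d14 := hd 1 4
  have d41 := hd 4 1
  have d23 := hd 2 3
  have d32 := hd 3 2
  have d24 := hd 2 4
  have d42 := hd 4 2
  have d34 := hd 3 4
  have d43 := hd 4 3
  rw [e0, e1] at d01 d10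
  rw [e0, e2] at d02 d20
  rw [e0, e3] at d03 d30
  rw [e0, e4] at d04 d40
  rw [e1, e2] at d12 d21
  rw [e1, e3] at d13 d31
  rw [e1, e4] at d14 d41
  rw [e2, e3] at d23 d32
  rw [e2, e4] at d24 d42
  rw [e3, e4] at d34 d43
  clear e0 e1 e2 e3 e4 hd hw h' h hn hn0 w
  generalize n 0 = a at *
  generalize n 1 = b at *
  generalize n 2 = c at *
  generalize n 3 = e at *
  -- Integer differences below 4 are at most 3, and one vertex has value 0, so every vertex value
  -- lies in `[-3, 3]`.
  have a1 : -3 ≤ a := by omega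
  have a2 : a ≤ 3 := by omega
  have b1 : -3 ≤ b := by omega
  have b2 : b ≤ 3 := by omega
  have c1 : -3 ≤ c := by omega
  have c2 : c ≤ 3 := by omega
  interval_cases a <;> interval_cases b <;> first | omega | (interval_cases c <;> omega)

/-- Take `101 q` copies of the simplex dilated by `102 q`: the dimension is `4 * 101 q` and the
width at least `4 * 102 q`. -/
theorem le_ws_mul (q : ℕ) (hq : q ≠ 0) : (q : ℝ≥0∞) * 408 ≤ ws (q * 404) := by
  have hq' : (q : ℝ) ≠ 0 := by exact_mod_cast hq
  have h := mul_latticeWidth_le_ws (d := 4) (k := q * 101) (D := q * 102) (by omega) (by omega)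
    emptySimplex_mem_intLattice emptySimplex_zero interior_emptySimplex_nonempty (by
      have : ((q * 102 : ℕ) : ℝ) / ((q * 101 : ℕ) : ℝ) = 102 / 101 := by
        push_cast
        rw [mul_div_mul_left _ _ hq']
      rw [this]
      exact isHollow_smul_emptySimplex)
  rw [mul_assoc q 101 4] at h
  refine le_trans ?_ h
  refine le_trans (le_of_eq ?_) (mul_le_mul_right four_le_latticeWidth_emptySimplex _)
  push_cast
  rw [mul_assoc]
  norm_num

/-! ### Existence of the limits and the final bounds. -/

theorem ws_div_le_liminf {d : ℕ} (hd : d ≠ 0) :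
    ws d / d ≤ liminf (fun n : ℕ => ws n / (n : ℝ≥0∞)) atTop := by
  rw [ENNReal.div_le_iff_le_mul (by simp [hd]) (by simp)]
  refine iSup_le fun K => iSup₂_le fun hK hh => ?_
  rw [← ENNReal.div_le_iff_le_mul (by simp [hd]) (by simp)]
  obtain ⟨v, hv0, hlat, hint, hhol, hle⟩ := hK.exists_zero_vertex hh
  refine div_le_liminf (monotone_nat_of_le_succ ws_le_succ) hd fun q hq => ?_
  have hq' : (q : ℝ) ≠ 0 := by exact_mod_cast hq
  refine (mul_le_mul_right hle _).trans (mul_latticeWidth_le_ws (Nat.pos_of_ne_zero hq)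
    (Nat.pos_of_ne_zero hq) hlat hv0 hint ?_)
  rwa [div_self hq', one_smul]

/-- If `b ≤ a` and every `a n / n` is at most `liminf (b n / n)`, then both ratios converge to
this lower limit. -/
theorem tendsto_div_of_le_liminf {a b : ℕ → ℝ≥0∞} (hba : ∀ n, b n ≤ a n)
    (h : ∀ n : ℕ, n ≠ 0 → a n / n ≤ liminf (fun n : ℕ => b n / (n : ℝ≥0∞)) atTop) :
    Tendsto (fun n : ℕ => b n / (n : ℝ≥0∞)) atTop
      (𝓝 (liminf (fun n : ℕ => b n / (n : ℝ≥0∞)) atTop)) ∧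
    Tendsto (fun n : ℕ => a n / (n : ℝ≥0∞)) atTop
      (𝓝 (liminf (fun n : ℕ => b n / (n : ℝ≥0∞)) atTop)) := by
  have hle (n : ℕ) : b n / (n : ℝ≥0∞) ≤ a n / (n : ℝ≥0∞) := by gcongr; exact hba n
  have hev : ∀ᶠ n : ℕ in atTop,
      a n / (n : ℝ≥0∞) ≤ liminf (fun n : ℕ => b n / (n : ℝ≥0∞)) atTop := by
    filter_upwards [eventually_ne_atTop 0] with n hn using h n hn
  exact ⟨tendsto_of_le_liminf_of_limsup_le le_rfl
      (limsup_le_of_le (h := hev.mono fun n hn => (hle n).trans hn)),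
    tendsto_of_le_liminf_of_limsup_le (liminf_le_liminf (Eventually.of_forall hle))
      (limsup_le_of_le (h := hev))⟩

end HollowWidth

theorem theorem1p4 :
    (∃ L : ℝ≥0∞,
      Tendsto (fun d : ℕ => HollowWidth.wp d / (d : ℝ≥0∞)) atTop (𝓝 L) ∧
      Tendsto (fun d : ℕ => HollowWidth.wc d / (d : ℝ≥0∞)) atTop (𝓝 L) ∧
      ENNReal.ofReal ((2 + Real.sqrt 2) / 3) ≤ L) ∧
    (∃ L : ℝ≥0∞,
      Tendsto (fun d : ℕ => HollowWidth.ws d / (d : ℝ≥0∞)) atTop (𝓝 L) ∧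
      (102 / 101 : ℝ≥0∞) ≤ L) := by
  refine ⟨?_, ?_⟩
  · obtain ⟨h1, h2⟩ := HollowWidth.tendsto_div_of_le_liminf HollowWidth.wp_le_wc
      fun n hn => HollowWidth.wc_div_le_liminf hn
    refine ⟨_, h1, h2, le_trans ?_ (HollowWidth.wc_div_le_liminf three_ne_zero)⟩
    rw [ENNReal.ofReal_div_of_pos (by norm_num)]
    refine (ENNReal.div_le_div_right HollowWidth.le_wc_three _).trans_eq ?_
    simp
  -- The width bound 4 in dimension 4 would only give 1; the family in dimensions `404 q` gives
  -- 408/404.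
  · refine ⟨_, (HollowWidth.tendsto_div_of_le_liminf (fun _ => le_rfl)
      fun n hn => HollowWidth.ws_div_le_liminf hn).1, le_trans (le_of_eq ?_)
      (HollowWidth.div_le_liminf (monotone_nat_of_le_succ HollowWidth.ws_le_succ)
        (by norm_num : 404 ≠ 0) HollowWidth.le_ws_mul)⟩
    rw [show (408 : ℝ≥0∞) = 4 * 102 by norm_num, show ((404 : ℕ) : ℝ≥0∞) = 4 * 101 by norm_num,
      ENNReal.mul_div_mul_left _ _ (by norm_num) (by norm_num)]
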